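/- Let $P$ be a finite set of points in the Euclidean plane, no three of them collinear. Write $\overline{\mathrm{cr}}(P)$ for the number of crossings in the complete geometric graph on $P$, that is, the number of unordered pairs of distinct straight-line segments spanned by points of $P$ that meet at a point interior to both. Call $P$ \emph{$3$-decomposable} if it can be partitioned into three sets $A$, $B$, $C$ of equal size for which there is a (nondegenerate) triangle $T$ enclosing $P$ such that the orthogonal projections of $P$ onto the (lines through the) three sides of $T$ show $A$ strictly between $B$ and $C$ on one side, $B$ strictly between $A$ and $C$ on another side, and $C$ strictly between $A$ and $B$ on the third side. \textbf{Theorem.} There is an absolute constant $K>0$ such that every $3$-decomposable set $P$ of $n$ points in general position (no three collinear) satisfies $$\overline{\mathrm{cr}}(P)\;\ge\;\frac{2}{27}\left(15-\pi^2\right)\binom{n}{4}-K\,n^3 .$$ Moreover $\frac{2}{27}(15-\pi^2)>0.380029$; hence $\overline{\mathrm{cr}}(P)\ge \frac{2}{27}(15-\pi^2)\binom n4+\Theta(n^3)>0.380029\binom n4+\Theta(n^3)$. -/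

import Mathlib

namespace GeometricDrawing

/-- The Euclidean plane. -/
abbrev Plane : Type := EuclideanSpace ℝ (Fin 2)

/-- A finite point set is in general position if no three of its points lie on a line. -/
def InGeneralPosition (P : Finset Plane) : Prop :=
  ∀ p ∈ P, ∀ q ∈ P, ∀ r ∈ P, p ≠ q → p ≠ r → q ≠ r → ¬ Collinear ℝ ({p, q, r} : Set Plane)

/-- The set of crossings of the complete geometric graph on `P`: the unordered pairs of distinct
edges `ab`, `cd` (straight segments with distinct end points in `P`) that meet at a point interior
to both. It is finite, being a set of unordered pairs of unordered pairs of points of `P`. -/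
def crossings (P : Finset Plane) : Set (Sym2 (Sym2 Plane)) :=
  {x | ∃ a ∈ P, ∃ b ∈ P, ∃ c ∈ P, ∃ d ∈ P,
    a ≠ b ∧ c ≠ d ∧ s(a, b) ≠ s(c, d) ∧ x = s(s(a, b), s(c, d)) ∧
    (openSegment ℝ a b ∩ openSegment ℝ c d).Nonempty}

/-- The number `cr(P)` of crossings of the complete geometric graph with vertex set `P`. -/
noncomputable def cr (P : Finset Plane) : ℕ := (crossings P).ncard

/-- The orthogonal projections onto a line through `p` and `q` show `X` between `Y` and `Z`: along
the line, all of `Y` comes before all of `X`, which comes before all of `Z`, or the other way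
round. The position of the projection of `x` along the line is measured by `⟪q - p, x⟫`. -/
def ShowsBetween (p q : Plane) (X Y Z : Finset Plane) : Prop :=
  (∀ x ∈ X, ∀ y ∈ Y, ∀ z ∈ Z,
    inner ℝ (q - p) y < inner ℝ (q - p) x ∧ inner ℝ (q - p) x < inner ℝ (q - p) z) ∨
  (∀ x ∈ X, ∀ y ∈ Y, ∀ z ∈ Z,
    inner ℝ (q - p) z < inner ℝ (q - p) x ∧ inner ℝ (q - p) x < inner ℝ (q - p) y)

/-- `P` is 3-decomposable: it is partitioned into three sets `A`, `B`, `C` of equal size, and there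
is a (nondegenerate) triangle `T` enclosing `P` such that the orthogonal projections of `P` onto
its three sides show `A` between `B` and `C` on one side, `B` between `A` and `C` on another one,
and `C` between `A` and `B` on the third one. -/
def ThreeDecomposable (P : Finset Plane) : Prop :=
  ∃ A B C : Finset Plane,
    (P : Set Plane) = A ∪ B ∪ C ∧
    Disjoint A B ∧ Disjoint A C ∧ Disjoint B C ∧
    A.card = B.card ∧ B.card = C.card ∧
    ∃ T : Affine.Triangle ℝ Plane,
      (P : Set Plane) ⊆ convexHull ℝ (Set.range T.points) ∧
      ShowsBetween (T.points 1) (T.points 2) A B C ∧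
      ShowsBetween (T.points 2) (T.points 0) B A C ∧
      ShowsBetween (T.points 0) (T.points 1) C A B

end GeometricDrawing

/-! Four points in general position are either in convex position, giving one crossing and two lines
(the diagonals) that separate the other two points, or one lies inside the triangle of the others,
giving no crossing and three separating lines. Summing over quadruples yields n⁴ ≤ 4 ∑ l·r + 8 cr +
6 n³, where l and r count the points on the two sides of the line ab (`card_pow_le_cr`). Few
balanced lines therefore force many crossings. By summation by parts (`sum_left_mul_left_le`) it
suffices to bound, for each k, the number of ordered pairs whose line has at least k points on each
side ("deep" pairs); these are weighted by w = n - 1 - 2k.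

Rotate a line about a point a of P by a half turn. The rank of a changes by one at each other point,
and the deep pairs are the changes inside a fixed window of ranks (`card_deep_sub_card_deep`). So if
a is the i-th point (from 0) of a class X of at most n/2 points cut off by a line, its deep
neighbours after it outnumber those before it by exactly n - 1 - 2 max(i, k). Summing over X counts
the deep pairs leaving X exactly. Inside X there remains an ordered graph whose forward degrees
exceed the backward ones by at most w, so at most wT edges leave the first T vertices. Cutting
repeatedly at the optimal place (`pairCount_le`) saves ∑ (2m - (j+1)(j+2)w)₊² / (8(j+1)(j+2)) from
the trivial bound m²/2, up to O(m). A 3-decomposable set consists of three such classes of size m =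
n/3.

Summing over k with weight w is a Riemann sum for integrals of x(a - px)₊². The result
(`CutPartition.cr_ge`) has a cubic error independent of the number J of series terms, so J can tend
to infinity; ∑ 1/((j+1)(j+2))³ = 10 - π² then gives the leading term (15 - π²)/4 · m⁴ = 2/27 (15 -
π²) n⁴/24. -/

namespace GeometricDrawing

open Finset

/-! ### Telescoping along a walk -/

/-- The number of ups minus downs, weighted by `φ`, of a walk telescopes. -/
theorem sum_walk {ι : Type*} [DecidableEq ι] (R : Finset ι) (τ : ι → ℝ) (U : ι → Prop)
    [DecidablePred U] (hτ : Set.InjOn τ R) (φ : ℕ → ℤ) :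
    ∑ q ∈ R, (if U q then (-1 : ℤ) else 1) *
      (φ (#{p ∈ R | (U p ∧ τ q < τ p) ∨ (¬ U p ∧ τ p < τ q)} + 1) -
        φ #{p ∈ R | (U p ∧ τ q < τ p) ∨ (¬ U p ∧ τ p < τ q)}) =
      φ #{p ∈ R | ¬ U p} - φ #{p ∈ R | U p} := by
  induction R using Finset.induction_on_max_value τ generalizing φ with
  | empty => simp
  | insert a s ha hmax ih =>
    have hlt : ∀ x ∈ s, τ x < τ a := fun x hx => lt_of_le_of_ne (hmax x hx) fun h =>
      ha (hτ (by simp [hx]) (by simp) h ▸ hx)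
    have hτ' : Set.InjOn τ s := hτ.mono (by simp)
    rw [sum_insert ha]
    by_cases hU : U a
    · have e1 : #{p ∈ insert a s | (U p ∧ τ a < τ p) ∨ (¬ U p ∧ τ p < τ a)} =
          #{p ∈ s | ¬ U p} := by
        congr 1
        ext p
        simp only [mem_filter, mem_insert]
        constructor
        · rintro ⟨rfl | hp, h | h⟩
          · exact absurd h.2 (lt_irrefl _)
          · exact absurd h.2 (lt_irrefl _)
          · exact absurd h.2 (not_lt.2 (hmax p hp))
          · exact ⟨hp, h.1⟩
        · rintro ⟨hp, h⟩
          exact ⟨Or.inr hp, Or.inr ⟨h, hlt p hp⟩⟩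
      have e2 : ∀ q ∈ s, #{p ∈ insert a s | (U p ∧ τ q < τ p) ∨ (¬ U p ∧ τ p < τ q)} =
          #{p ∈ s | (U p ∧ τ q < τ p) ∨ (¬ U p ∧ τ p < τ q)} + 1 := by
        intro q hq
        rw [filter_insert, if_pos (Or.inl ⟨hU, hlt q hq⟩), card_insert_of_notMem]
        simp [ha]
      -- The last event, if of type `U`, is still counted at every earlier one. The earlier events
      -- thus form the same walk raised by one, which is why `φ` is generalized.
      rw [e1, sum_congr rfl (fun q hq => by rw [e2 q hq]), ih hτ' (fun i => φ (i + 1)),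
        filter_insert, if_neg (not_not.2 hU), filter_insert, if_pos hU, if_pos hU,
        card_insert_of_notMem (by simp [ha])]
      ring
    · have e1 : #{p ∈ insert a s | (U p ∧ τ a < τ p) ∨ (¬ U p ∧ τ p < τ a)} =
          #{p ∈ s | ¬ U p} := by
        congr 1
        ext p
        simp only [mem_filter, mem_insert]
        constructor
        · rintro ⟨rfl | hp, h | h⟩
          · exact absurd h.2 (lt_irrefl _)
          · exact absurd h.2 (lt_irrefl _)
          · exact absurd h.2 (not_lt.2 (hmax p hp))
          · exact ⟨hp, h.1⟩
        · rintro ⟨hp, h⟩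
          exact ⟨Or.inr hp, Or.inr ⟨h, hlt p hp⟩⟩
      have e2 : ∀ q ∈ s, #{p ∈ insert a s | (U p ∧ τ q < τ p) ∨ (¬ U p ∧ τ p < τ q)} =
          #{p ∈ s | (U p ∧ τ q < τ p) ∨ (¬ U p ∧ τ p < τ q)} := by
        intro q hq
        rw [filter_insert, if_neg]
        rintro (h | h)
        · exact hU h.1
        · exact lt_asymm h.2 (hlt q hq)
      rw [e1, sum_congr rfl (fun q hq => by rw [e2 q hq]), ih hτ' φ,
        filter_insert, if_pos hU, filter_insert, if_neg hU,
        card_insert_of_notMem (by simp [ha]), if_neg hU]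
      ring

/-! ### Edges of ordered graphs with bounded degree excess -/

/-- The number of pairs `i < j < T` in the relation `R`. -/
noncomputable def pairCount (R : ℕ → ℕ → Prop) (T : ℕ) : ℕ := by
  classical exact ∑ j ∈ range T, #{i ∈ range j | R i j}

open Classical in
/-- If every out-degree exceeds the in-degree by at most `w`, then at most `w * T` edges cross the
cut at `T`. -/
theorem pairCount_le_add (R : ℕ → ℕ → Prop) (hR : ∀ i j, R i j → R j i) (m : ℕ) (w : ℝ)
    (hw : ∀ i < m, (#{j ∈ range m | i < j ∧ R i j} : ℝ) - #{j ∈ range m | j < i ∧ R i j} ≤ w)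
    {T T' : ℕ} (hT : T ≤ T') (hT' : T' ≤ m) :
    (pairCount R T' : ℝ) ≤ pairCount R T + w * T + (T' - T : ℝ) ^ 2 / 2 := by
  -- the edges crossing the cut at `T`
  have cut : ∑ i ∈ range T, ((#{j ∈ range m | i < j ∧ R i j} : ℝ) -
      #{j ∈ range m | j < i ∧ R i j}) = ∑ i ∈ range T, (#{j ∈ Ico T m | R i j} : ℝ) := by
    have h1 : ∀ i ∈ range T, (#{j ∈ range m | i < j ∧ R i j} : ℝ) =
        #{j ∈ Ico T m | R i j} + #{j ∈ range T | i < j ∧ R i j} := by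
      intro i hi
      rw [mem_range] at hi
      norm_cast
      rw [← card_union_of_disjoint]
      · congr 1
        ext j
        simp only [mem_filter, mem_range, mem_union, mem_Ico]
        constructor
        · rintro ⟨h1, h2, h3⟩
          by_cases h : T ≤ j
          · exact Or.inl ⟨⟨h, h1⟩, h3⟩
          · exact Or.inr ⟨by omega, h2, h3⟩
        · rintro (⟨⟨h, h1⟩, h3⟩ | ⟨h, h2, h3⟩)
          · exact ⟨h1, by omega, h3⟩
          · exact ⟨by omega, h2, h3⟩
      · rw [disjoint_left]
        intro j
        simp only [mem_filter, mem_range, mem_Ico]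
        omega
    -- An edge with both ends below `T` is forward for one end and backward for the other, so it
    -- cancels; only edges across the cut survive.
    have h2 : ∑ i ∈ range T, (#{j ∈ range T | i < j ∧ R i j} : ℝ) =
        ∑ i ∈ range T, (#{j ∈ range m | j < i ∧ R i j} : ℝ) := by
      have h3 : ∀ i ∈ range T, (#{j ∈ range m | j < i ∧ R i j} : ℝ) =
          #{j ∈ range T | j < i ∧ R i j} := by
        intro i hi
        rw [mem_range] at hi
        congr 2
        ext j
        simp only [mem_filter, mem_range]
        constructor
        · rintro ⟨h1, h2, h3⟩
          exact ⟨by omega, h2, h3⟩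
        · rintro ⟨h1, h2, h3⟩
          exact ⟨by omega, h2, h3⟩
      rw [sum_congr rfl h3]
      simp only [card_filter, Nat.cast_sum]
      rw [sum_comm]
      refine sum_congr rfl fun i _ => sum_congr rfl fun j _ => ?_
      have : (j < i ∧ R j i) ↔ (j < i ∧ R i j) := and_congr_right fun _ => ⟨hR _ _, hR _ _⟩
      simp [this]
    rw [sum_sub_distrib, sum_congr rfl h1, sum_add_distrib, h2]
    ring
  have cut' : ∑ i ∈ range T, (#{j ∈ Ico T m | R i j} : ℝ) ≤ w * T := by
    rw [← cut]
    calc _ ≤ ∑ i ∈ range T, w := sum_le_sum fun i hi => hw i (by rw [mem_range] at hi; omega)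
      _ = w * T := by simp [mul_comm]
  have split : (pairCount R T' : ℝ) = pairCount R T +
      ∑ j ∈ Ico T T', (#{i ∈ range j | R i j} : ℝ) := by
    unfold pairCount
    rw [← sum_range_add_sum_Ico _ hT]
    push_cast
    ring
  have split2 : ∀ j ∈ Ico T T', (#{i ∈ range j | R i j} : ℝ) ≤
      #{i ∈ range T | R i j} + ((j : ℝ) - T) := by
    intro j hj
    rw [mem_Ico] at hj
    have h1 : #{i ∈ range j | R i j} ≤ #{i ∈ range T | R i j} + #(Ico T j) := by
      refine le_trans (card_le_card ?_) (card_union_le _ _)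
      intro i
      simp only [mem_filter, mem_range, mem_union, mem_Ico]
      rintro ⟨h1, h2⟩
      by_cases h : i < T
      · exact Or.inl ⟨h, h2⟩
      · exact Or.inr ⟨by omega, h1⟩
    rw [Nat.card_Ico] at h1
    have h2 : (#{i ∈ range j | R i j} : ℝ) ≤ #{i ∈ range T | R i j} + ((j - T : ℕ) : ℝ) := by
      exact_mod_cast h1
    rwa [Nat.cast_sub hj.1] at h2
  have h3 : ∑ j ∈ Ico T T', (#{i ∈ range T | R i j} : ℝ) ≤
      ∑ i ∈ range T, (#{j ∈ Ico T m | R i j} : ℝ) := by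
    simp only [card_filter, Nat.cast_sum]
    rw [sum_comm]
    refine sum_le_sum fun i _ => sum_le_sum_of_subset_of_nonneg (Ico_subset_Ico le_rfl hT') ?_
    intros
    positivity
  have h4 : ∑ j ∈ Ico T T', ((j : ℝ) - T) ≤ (T' - T : ℝ) ^ 2 / 2 := by
    rw [sum_Ico_eq_sum_range]
    have h5 : ∀ N : ℕ, ∑ i ∈ range N, (((T + i : ℕ) : ℝ) - T) ≤ (N : ℝ) ^ 2 / 2 := by
      intro N
      induction N with
      | zero => simp
      | succ N ih =>
        rw [sum_range_succ]
        push_cast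
        push_cast at ih
        nlinarith
    have := h5 (T' - T)
    rwa [Nat.cast_sub hT] at this
  have h5 := sum_le_sum split2
  rw [sum_add_distrib] at h5
  linarith

open Classical in
-- Induction on the number `s` of cuts: split at some t < T, bound the edges below t inductively,
-- those across t by wt, and those above trivially. The lower bound on `T` makes every term of the
-- sum the square of a nonnegative number and is inherited by the optimal t. Each rounding of t to
-- an integer costs at most 1, whence the final `s`.
theorem pairCount_le_of_level (R : ℕ → ℕ → Prop) (hR : ∀ i j, R i j → R j i) (m : ℕ) (w : ℝ)
    (hw0 : 0 ≤ w)
    (hw : ∀ i < m, (#{j ∈ range m | i < j ∧ R i j} : ℝ) - #{j ∈ range m | j < i ∧ R i j} ≤ w)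
    (s : ℕ) : ∀ T ≤ m, ((s : ℝ) + 1) * s * w ≤ 2 * T →
    (pairCount R T : ℝ) ≤ (T : ℝ) ^ 2 / 2 -
      ∑ j ∈ range s, (2 * T - ((j : ℝ) + 1) * (j + 2) * w) ^ 2 / (8 * ((j + 1) * (j + 2))) + s := by
  have closed : ∀ (s : ℕ) (T : ℝ), T ^ 2 / 2 -
      ∑ j ∈ range s, (2 * T - ((j : ℝ) + 1) * (j + 2) * w) ^ 2 / (8 * ((j + 1) * (j + 2))) =
      T ^ 2 / (2 * (s + 1)) + s * T * w / 2 - w ^ 2 * (s * (s + 1) * (s + 2)) / 24 := by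
    intro s T
    induction s with
    | zero => simp
    | succ s ih =>
      rw [sum_range_succ, ← sub_sub, ih]
      push_cast
      field_simp
      ring
  induction s with
  | zero =>
    intro T hT _
    have := pairCount_le_add R hR m w hw (Nat.zero_le T) hT
    simp [pairCount] at this ⊢
    exact this
  | succ s ih =>
    intro T hT hs
    rw [closed]
    push_cast at hs ⊢
    have hs0 : (0 : ℝ) ≤ s := Nat.cast_nonneg s
    -- The minimizer in t of the closed form for `s` cuts plus wt + (T - t)²/2.
    set t : ℝ := T * (s + 1) / (s + 2) - w * (s + 1) / 2 with ht
    have h1 : ((s : ℝ) + 1) * s * w ≤ 2 * t := by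
      have : 2 * t - (s + 1) * s * w = (s + 1) / (s + 2) * (2 * T - (s + 1 + 1) * (s + 1) * w) := by
        rw [ht]; field_simp; ring
      have h2 : 0 ≤ ((s : ℝ) + 1) / (s + 2) * (2 * T - (s + 1 + 1) * (s + 1) * w) :=
        mul_nonneg (by positivity) (by linarith)
      linarith
    have h0 : 0 ≤ t := by
      have : 0 ≤ ((s : ℝ) + 1) * s * w := by positivity
      linarith
    have h2 : t ≤ T := by
      have e : (T : ℝ) - t = T / (s + 2) + w * (s + 1) / 2 := by rw [ht]; field_simp; ring
      have : 0 ≤ (T : ℝ) / (s + 2) + w * (s + 1) / 2 := by positivity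
      linarith
    have h3 : ⌈t⌉₊ ≤ T := Nat.ceil_le.2 h2
    have h4 := Nat.le_ceil t
    have h5 := (Nat.ceil_lt_add_one h0).le
    have h6 := ih ⌈t⌉₊ (h3.trans hT) (by linarith)
    rw [closed] at h6
    have h7 := pairCount_le_add R hR m w hw h3 hT
    set c : ℝ := (⌈t⌉₊ : ℝ) with hc
    have h8 : c ^ 2 / (2 * (s + 1)) + s * c * w / 2 - w ^ 2 * (s * (s + 1) * (s + 2)) / 24
        + w * c + (T - c) ^ 2 / 2 =
        (T : ℝ) ^ 2 / (2 * (s + 1 + 1)) + (s + 1) * T * w / 2 -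
          w ^ 2 * ((s + 1) * (s + 1 + 1) * (s + 1 + 2)) / 24 +
          (s + 2) / (2 * (s + 1)) * (c - t) ^ 2 := by
      rw [ht]
      field_simp
      ring
    have h9 : ((s : ℝ) + 2) / (2 * (s + 1)) * (c - t) ^ 2 ≤ 1 * 1 := by
      apply mul_le_mul _ _ (sq_nonneg _) zero_le_one
      · rw [div_le_one (by positivity)]; linarith
      · nlinarith
    linarith

open Classical in
-- The truncation at 0 selects the admissible number of cuts automatically, so `J` is free. As `w`
-- is at least 1, at most 2m cuts are admissible, which bounds the rounding cost uniformly in `J`.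
theorem pairCount_le (R : ℕ → ℕ → Prop) (hR : ∀ i j, R i j → R j i) (m : ℕ) (w : ℝ)
    (hw1 : 1 ≤ w)
    (hw : ∀ i < m, (#{j ∈ range m | i < j ∧ R i j} : ℝ) - #{j ∈ range m | j < i ∧ R i j} ≤ w)
    (J : ℕ) :
    (pairCount R m : ℝ) ≤ (m : ℝ) ^ 2 / 2 -
      ∑ j ∈ range J, (max 0 (2 * m - ((j : ℝ) + 1) * (j + 2) * w)) ^ 2 /
        (8 * ((j + 1) * (j + 2))) + 2 * m := by
  induction J with
  | zero =>
    have := pairCount_le_of_level R hR m w (by linarith) hw 0 m le_rfl (by simp)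
    simp at this ⊢
    have : (0 : ℝ) ≤ m := Nat.cast_nonneg m
    linarith
  | succ J ih =>
    by_cases h : ((J : ℝ) + 1) * (J + 2) * w ≤ 2 * m
    · have hJ : (0 : ℝ) ≤ J := Nat.cast_nonneg J
      have h1 := pairCount_le_of_level R hR m w (by linarith) hw (J + 1) m le_rfl (by
        push_cast; nlinarith)
      have h2 : ∀ j ∈ range (J + 1), (max 0 (2 * m - ((j : ℝ) + 1) * (j + 2) * w)) ^ 2 /
          (8 * ((j + 1) * (j + 2))) =
          (2 * m - ((j : ℝ) + 1) * (j + 2) * w) ^ 2 / (8 * ((j + 1) * (j + 2))) := by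
        intro j hj
        have hj' : (j : ℝ) ≤ J := by
          rw [mem_range] at hj; exact_mod_cast Nat.lt_succ_iff.1 hj
        have hj0 : (0 : ℝ) ≤ j := Nat.cast_nonneg j
        rw [max_eq_right]
        have : ((j : ℝ) + 1) * (j + 2) * w ≤ ((J : ℝ) + 1) * (J + 2) * w := by gcongr
        linarith
      rw [sum_congr rfl h2]
      push_cast at h1 ⊢
      have : ((J : ℝ) + 1) ≤ 2 * m := by
        have h3 : ((J : ℝ) + 1) * 1 * 1 ≤ ((J : ℝ) + 1) * (J + 2) * w := by gcongr; linarith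
        linarith
      linarith
    · rw [sum_range_succ, max_eq_left (by linarith)]
      simpa using ih

/-! ### Riemann sums -/

/-- A primitive, vanishing at infinity, of `-x (a - p x)₊²`. -/
noncomputable def tailIntegral (a p x : ℝ) : ℝ :=
  (a * (max 0 (a - p * x)) ^ 3 / 3 - (max 0 (a - p * x)) ^ 4 / 4) / p ^ 2

/-- The left side is the integral of t(a - pt)₊² over [x, x + d], where t ≤ x + d and the square is
largest at x. -/
theorem tailIntegral_sub_le {a p x d : ℝ} (hp : 1 ≤ p) (hx : 0 ≤ x) (hd : 0 ≤ d) :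
    tailIntegral a p x - tailIntegral a p (x + d) ≤
      d * (x * (max 0 (a - p * x)) ^ 2) + d ^ 2 * (max 0 (a - p * x)) ^ 2 := by
  have hp0 : 0 < p := by linarith
  unfold tailIntegral
  rcases le_total (a - p * x) 0 with h | h
  · have h' : a - p * (x + d) ≤ 0 := by nlinarith
    simp [max_eq_left h, max_eq_left h']
  · rw [max_eq_right h]
    set U := a - p * x with hU
    have ha : a = U + p * x := by rw [hU]; ring
    rcases le_total (a - p * (x + d)) 0 with h' | h'
    · rw [max_eq_left h']
      have hUd : U ≤ p * d := by nlinarith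
      have e : (a * U ^ 3 / 3 - U ^ 4 / 4) / p ^ 2 =
          x * U ^ 2 * (U / p) / 3 + U ^ 2 * (U / p) ^ 2 / 12 := by
        rw [ha]; field_simp; ring
      have hq : U / p ≤ d := by rw [div_le_iff₀ hp0]; linarith
      have hq0 : 0 ≤ U / p := by positivity
      have e1 : x * U ^ 2 * (U / p) / 3 ≤ x * U ^ 2 * d := by
        have : x * U ^ 2 * (U / p) ≤ x * U ^ 2 * d := by gcongr
        have : 0 ≤ x * U ^ 2 * (U / p) := by positivity
        linarith
      have e2 : U ^ 2 * (U / p) ^ 2 / 12 ≤ U ^ 2 * d ^ 2 := by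
        have : U ^ 2 * (U / p) ^ 2 ≤ U ^ 2 * d ^ 2 := by gcongr
        have : 0 ≤ U ^ 2 * (U / p) ^ 2 := by positivity
        linarith
      rw [e]
      simp
      linarith
    · rw [max_eq_right h']
      set V := a - p * (x + d) with hV
      have hVU : U = V + p * d := by rw [hV, hU]; ring
      have e : d * (x * U ^ 2) + d ^ 2 * U ^ 2 -
          ((a * U ^ 3 / 3 - U ^ 4 / 4) / p ^ 2 - (a * V ^ 3 / 3 - V ^ 4 / 4) / p ^ 2) =
          x * (V * p * d ^ 2 + p ^ 2 * d ^ 3 * (2 / 3)) +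
          (V ^ 2 * d ^ 2 / 2 + V * p * d ^ 3 * (5 / 3) + p ^ 2 * d ^ 4 * (11 / 12)) := by
        rw [ha, hVU]; field_simp; ring
      have : 0 ≤ x * (V * p * d ^ 2 + p ^ 2 * d ^ 3 * (2 / 3)) +
          (V ^ 2 * d ^ 2 / 2 + V * p * d ^ 3 * (5 / 3) + p ^ 2 * d ^ 4 * (11 / 12)) := by
        positivity
      linarith

/-- A Riemann sum of step 2, hence half of the integral a⁴/(12p²) of x(a - px)₊² over x ≥ 0. The
conditions on `a` and `p` keep the support inside [0, n]. -/
theorem sum_mul_sq_ge (n : ℕ) {a p : ℝ} (hp : 1 ≤ p) (ha : 0 ≤ a) (han : a ≤ n) :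
    a ^ 4 / (24 * p ^ 2) - 4 * (n : ℝ) ^ 3 ≤
      ∑ k ∈ range (n / 2), ((n : ℝ) - 1 - 2 * k) * (max 0 (a - p * (n - 1 - 2 * k))) ^ 2 := by
  have hp0 : 0 < p := by linarith
  rcases Nat.eq_zero_or_pos n with rfl | hn
  · have : a = 0 := le_antisymm (by simpa using han) ha
    simp [this]
  have hn1 : (1 : ℝ) ≤ n := by exact_mod_cast hn
  have hw : ∀ k ∈ range (n / 2), (0 : ℝ) ≤ (n : ℝ) - 1 - 2 * k := by
    intro k hk
    rw [mem_range] at hk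
    have : 1 + 2 * k ≤ n := by omega
    have : (1 : ℝ) + 2 * k ≤ n := by exact_mod_cast this
    linarith
  have hmax : ∀ x : ℝ, 0 ≤ x → (max 0 (a - p * x)) ^ 2 ≤ a ^ 2 := by
    intro x hx
    have : max 0 (a - p * x) ≤ a := max_le ha (by nlinarith)
    exact pow_le_pow_left₀ (le_max_left _ _) this 2
  have step : ∀ k ∈ range (n / 2),
      tailIntegral a p (n + 1 - 2 * ((k + 1 : ℕ) : ℝ)) - tailIntegral a p (n + 1 - 2 * (k : ℝ)) ≤
      2 * (((n : ℝ) - 1 - 2 * k) * (max 0 (a - p * (n - 1 - 2 * k))) ^ 2) + 4 * (n : ℝ) ^ 2 := by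
    intro k hk
    have h := tailIntegral_sub_le (a := a) hp (hw k hk) (d := 2) (by norm_num)
    have h2 := hmax _ (hw k hk)
    have h3 : a ^ 2 ≤ (n : ℝ) ^ 2 := pow_le_pow_left₀ ha han 2
    have e1 : (n : ℝ) + 1 - 2 * ((k + 1 : ℕ) : ℝ) = n - 1 - 2 * k := by push_cast; ring
    have e2 : (n : ℝ) + 1 - 2 * (k : ℝ) = n - 1 - 2 * k + 2 := by ring
    rw [e1, e2]
    linarith
  have hsum := sum_le_sum step
  rw [sum_range_sub (fun k : ℕ => tailIntegral a p (n + 1 - 2 * (k : ℝ))), sum_add_distrib,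
    ← mul_sum] at hsum
  simp only [sum_const, card_range, nsmul_eq_mul, Nat.cast_zero, mul_zero, sub_zero] at hsum
  have hlast : tailIntegral a p (n + 1) = 0 := by
    have : a - p * (n + 1) ≤ 0 := by nlinarith
    simp [tailIntegral, max_eq_left this]
  set N : ℝ := ((n / 2 : ℕ) : ℝ) with hN
  have hN1 : 2 * N ≤ n := by
    have : 2 * (n / 2) ≤ n := by omega
    rw [hN]; exact_mod_cast this
  have hN2 : (n : ℝ) + 1 - 2 * N ≤ 2 := by
    have : n ≤ 2 * (n / 2) + 1 := by omega
    have : (n : ℝ) ≤ 2 * N + 1 := by rw [hN]; exact_mod_cast this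
    linarith
  have hN3 : (0 : ℝ) ≤ n + 1 - 2 * N := by linarith
  have hfirst := tailIntegral_sub_le (a := a) (p := p) (x := 0) hp le_rfl hN3
  have h0 : tailIntegral a p 0 = a ^ 4 / (12 * p ^ 2) := by
    simp only [tailIntegral, mul_zero, sub_zero, max_eq_right ha]
    field_simp; ring
  simp only [mul_zero, sub_zero, zero_mul, zero_add, max_eq_right ha, h0] at hfirst
  have h4 : ((n : ℝ) + 1 - 2 * N) ^ 2 * a ^ 2 ≤ 2 ^ 2 * (n : ℝ) ^ 2 := by gcongr
  rw [hlast] at hsum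
  have h5 : a ^ 4 / (12 * p ^ 2) = 2 * (a ^ 4 / (24 * p ^ 2)) := by field_simp; ring
  have h6 : (n : ℝ) ^ 2 ≤ (n : ℝ) ^ 3 := by nlinarith [sq_nonneg (n : ℝ)]
  have h7 : N * (4 * (n : ℝ) ^ 2) ≤ 2 * (n : ℝ) ^ 3 := by nlinarith [sq_nonneg (n : ℝ)]
  have h8 : (0 : ℝ) ≤ (n : ℝ) ^ 3 := by positivity
  linarith

theorem sum_width_le (n : ℕ) :
    ∑ k ∈ range (n / 2), ((n : ℝ) - 1 - 2 * k) ≤ (n : ℝ) ^ 2 / 4 := by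
  have h : ∀ N : ℕ, ∑ k ∈ range N, ((n : ℝ) - 1 - 2 * k) = N * (n - N) := by
    intro N
    induction N with
    | zero => simp
    | succ N ih => rw [sum_range_succ, ih]; push_cast; ring
  rw [h]
  nlinarith [sq_nonneg ((n : ℝ) - 2 * ((n / 2 : ℕ) : ℝ))]

/-! ### The series and the constant -/

/-- With u = 1/(j+1) and v = 1/(j+2) one has uv = u - v, so (uv)³ = u³ - v³ - 3u² - 3v² + 6(u - v):
all but the squares telescopes, and the squares lead to ζ(2). -/
theorem sum_inv_cube_telescope (J : ℕ) :
    ∑ j ∈ range J, 1 / (((j : ℝ) + 1) * (j + 2)) ^ 3 =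
      7 - 1 / ((J : ℝ) + 1) ^ 3 - 6 / ((J : ℝ) + 1) -
        3 * ∑ j ∈ range J, 1 / ((j : ℝ) + 1) ^ 2 - 3 * ∑ j ∈ range (J + 1), 1 / ((j : ℝ) + 1) ^ 2 +
        3 := by
  induction J with
  | zero => norm_num
  | succ J ih =>
    rw [sum_range_succ, ih, sum_range_succ _ (J + 1), sum_range_succ _ J]
    push_cast
    field_simp
    ring

theorem tendsto_sum_inv_cube :
    Filter.Tendsto (fun J : ℕ => ∑ j ∈ range J, 1 / (((j : ℝ) + 1) * (j + 2)) ^ 3) Filter.atTop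
      (nhds (10 - Real.pi ^ 2)) := by
  have hz : Filter.Tendsto (fun J : ℕ => ∑ j ∈ range J, 1 / ((j : ℝ) + 1) ^ 2) Filter.atTop
      (nhds (Real.pi ^ 2 / 6)) := by
    have h := hasSum_zeta_two
    rw [hasSum_nat_add_iff' 1 |>.symm] at h
    have h2 := h.tendsto_sum_nat
    simpa using h2
  have hz1 := hz.comp (Filter.tendsto_add_atTop_nat 1)
  have h0 : Filter.Tendsto (fun J : ℕ => 1 / ((J : ℝ) + 1)) Filter.atTop (nhds 0) :=
    tendsto_one_div_add_atTop_nhds_zero_nat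
  have := ((((((h0.pow 3).const_sub 7).sub (h0.const_mul 6)).sub (hz.const_mul 3)).sub
    (hz1.const_mul 3)).add_const 3)
  refine (this.congr fun J => ?_).trans (by
    apply le_of_eq; congr 1; ring)
  rw [sum_inv_cube_telescope]
  simp only [Function.comp, one_div_pow]
  ring

/-- Keeps the accumulated Riemann-sum errors bounded independently of `J`. -/
theorem sum_inv_le_one (J : ℕ) : ∑ j ∈ range J, 1 / (((j : ℝ) + 2) * (j + 3)) ≤ 1 := by
  have h : ∑ j ∈ range J, 1 / (((j : ℝ) + 2) * (j + 3)) = 1 / 2 - 1 / (J + 2) := by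
    induction J with
    | zero => norm_num
    | succ J ih =>
      rw [sum_range_succ, ih]
      push_cast
      field_simp
      ring
  rw [h]
  have : (0 : ℝ) ≤ 1 / (J + 2) := by positivity
  linarith

theorem constant_gt : (2 / 27 * (15 - Real.pi ^ 2) : ℝ) > 0.380029 := by
  have h1 := Real.pi_lt_d6
  have h2 := Real.pi_pos
  nlinarith

/-! ### Orientations and crossings of four points -/

/-- Twice the signed area of the triangle `abc`. -/
noncomputable def orient (a b c : Plane) : ℝ :=
  (b 0 - a 0) * (c 1 - a 1) - (b 1 - a 1) * (c 0 - a 0)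

theorem orient_swap (a b c : Plane) : orient b a c = -orient a b c := by
  unfold orient; ring

theorem orient_ne_zero {P : Finset Plane} (hP : InGeneralPosition P) {a b c : Plane}
    (ha : a ∈ P) (hb : b ∈ P) (hc : c ∈ P) (hab : a ≠ b) (hac : a ≠ c) (hbc : b ≠ c) :
    orient a b c ≠ 0 := by
  intro h
  apply hP a ha b hb c hc hab hac hbc
  rw [collinear_iff_of_mem (p₀ := a) (by simp)]
  refine ⟨b - a, ?_⟩
  have key : ∃ r : ℝ, c 0 = r * (b 0 - a 0) + a 0 ∧ c 1 = r * (b 1 - a 1) + a 1 := by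
    unfold orient at h
    by_cases h0 : b 0 - a 0 = 0
    · have h1 : b 1 - a 1 ≠ 0 := by
        intro h1
        apply hab
        ext i
        fin_cases i
        · simp; linarith
        · simp; linarith
      refine ⟨(c 1 - a 1) / (b 1 - a 1), ?_, ?_⟩
      · rw [h0] at h ⊢
        have : c 0 - a 0 = 0 := by
          have : (b 1 - a 1) * (c 0 - a 0) = 0 := by linarith
          exact (mul_eq_zero.1 this).resolve_left h1
        linarith
      · field_simp; ring
    · refine ⟨(c 0 - a 0) / (b 0 - a 0), ?_, ?_⟩
      · field_simp; ring
      · field_simp; linarith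
  obtain ⟨r, h0, h1⟩ := key
  intro p hp
  simp only [Set.mem_insert_iff, Set.mem_singleton_iff] at hp
  rcases hp with rfl | rfl | rfl
  · exact ⟨0, by simp⟩
  · exact ⟨1, by simp⟩
  · refine ⟨r, ?_⟩
    ext i
    fin_cases i
    · simpa using h0
    · simpa using h1

/-- The line through `a` and `b` strictly separates `c` and `d`. -/
def Separates (a b c d : Plane) : Prop :=
  (0 < orient a b c ∧ orient a b d < 0) ∨ (orient a b c < 0 ∧ 0 < orient a b d)

theorem inter_of_pos {a b c d : Plane} {α β γ δ : ℝ} (hα : 0 < α) (hβ : 0 < β) (hγ : 0 < γ)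
    (hδ : 0 < δ) (hsum : α + β = γ + δ) (h0 : α * a 0 + β * b 0 = γ * c 0 + δ * d 0)
    (h1 : α * a 1 + β * b 1 = γ * c 1 + δ * d 1) :
    (openSegment ℝ a b ∩ openSegment ℝ c d).Nonempty := by
  have hs : 0 < α + β := by linarith
  refine ⟨(α / (α + β)) • a + (β / (α + β)) • b, ⟨_, _, by positivity, by positivity, ?_, rfl⟩,
    ⟨γ / (α + β), δ / (α + β), by positivity, by positivity, ?_, ?_⟩⟩
  · field_simp
  · rw [← add_div, ← hsum]; field_simp
  · ext i
    fin_cases i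
    · simp
      field_simp
      linarith
    · simp
      field_simp
      linarith

/-- The four orientations are the coefficients of the affine dependence among a, b, c, d (Cramer's
rule); mutual separation gives them the signs that make both sides positive combinations. -/
theorem inter_of_separates {a b c d : Plane} (h1 : Separates a b c d) (h2 : Separates c d a b) :
    (openSegment ℝ a b ∩ openSegment ℝ c d).Nonempty := by
  have hs : orient c d b + -orient c d a = -orient a b d + orient a b c := by
    unfold orient; ring
  have e0 : orient c d b * a 0 + -orient c d a * b 0 =
      -orient a b d * c 0 + orient a b c * d 0 := by
    unfold orient; ring
  have e1 : orient c d b * a 1 + -orient c d a * b 1 =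
      -orient a b d * c 1 + orient a b c * d 1 := by
    unfold orient; ring
  rcases h1 with ⟨h1, h1'⟩ | ⟨h1, h1'⟩ <;> rcases h2 with ⟨h2, h2'⟩ | ⟨h2, h2'⟩
  · linarith
  · exact inter_of_pos h2' (neg_pos.2 h2) (neg_pos.2 h1') h1 hs e0 e1
  · exact inter_of_pos (neg_pos.2 h2') h2 h1' (neg_pos.2 h1) (by linarith) (by linarith)
      (by linarith)
  · linarith

open Classical in
/-- Among four points, the pairs whose line separates the other two, together with the crossings,
number at least three. -/
theorem three_le_separates {a b c d : Plane} (h1 : orient a b c ≠ 0) (h2 : orient a b d ≠ 0)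
    (h3 : orient a c d ≠ 0) (h4 : orient b c d ≠ 0) :
    3 ≤ ((if Separates a b c d then 1 else 0) + (if Separates c d a b then 1 else 0) +
        (if Separates a b c d ∧ Separates c d a b then 1 else 0)) +
      ((if Separates a c b d then 1 else 0) + (if Separates b d a c then 1 else 0) +
        (if Separates a c b d ∧ Separates b d a c then 1 else 0)) +
      ((if Separates a d b c then 1 else 0) + (if Separates b c a d then 1 else 0) +
        (if Separates a d b c ∧ Separates b c a d then 1 else 0)) := by
  have e1 : orient c d a = orient a c d := by unfold orient; ring
  have e2 : orient c d b = orient b c d := by unfold orient; ring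
  have e3 : orient a c b = -orient a b c := by unfold orient; ring
  have e4 : orient b d a = orient a b d := by unfold orient; ring
  have e5 : orient b d c = -orient b c d := by unfold orient; ring
  have e6 : orient a d b = -orient a b d := by unfold orient; ring
  have e7 : orient a d c = -orient a c d := by unfold orient; ring
  have e8 : orient b c a = orient a b c := by unfold orient; ring
  simp only [Separates, e1, e2, e3, e4, e5, e6, e7, e8]
  -- All sixteen sign patterns, including the two that no planar quadruple realizes. Convex position
  -- contributes 2 + 1, a point inside the triangle of the others contributes 3 + 0.
  rcases lt_or_gt_of_ne h1 with h1 | h1 <;> rcases lt_or_gt_of_ne h2 with h2 | h2 <;>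
  rcases lt_or_gt_of_ne h3 with h3 | h3 <;> rcases lt_or_gt_of_ne h4 with h4 | h4 <;>
  simp [h1, h2, h3, h4, not_lt.2 h1.le, not_lt.2 h2.le, not_lt.2 h3.le,
    not_lt.2 h4.le]

/-! ### Double counting over quadruples -/

open Classical in
/-- The number of points of `P` to the left of the directed line `ab`. -/
noncomputable def left (P : Finset Plane) (a b : Plane) : ℕ := #{p ∈ P | 0 < orient a b p}

open Classical in
theorem left_swap (P : Finset Plane) (a b : Plane) :
    left P b a = #{p ∈ P | orient a b p < 0} := by
  simp [left, orient_swap a b]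

theorem left_add_left {P : Finset Plane} (hP : InGeneralPosition P) {a b : Plane} (ha : a ∈ P)
    (hb : b ∈ P) (hab : a ≠ b) : left P a b + left P b a + 2 = #P := by
  classical
  rw [left_swap P a b, left, ← card_union_of_disjoint]
  · have : ({p ∈ P | 0 < orient a b p} ∪ {p ∈ P | orient a b p < 0} : Finset Plane) =
        (P.erase a).erase b := by
      ext p
      simp only [mem_union, mem_filter, mem_erase]
      constructor
      · rintro (⟨h1, h2⟩ | ⟨h1, h2⟩)
        all_goals
          refine ⟨?_, ?_, h1⟩
          all_goals
            rintro rfl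
            simp [orient, mul_comm] at h2
      · rintro ⟨h1, h2, h3⟩
        rcases lt_or_gt_of_ne (orient_ne_zero hP ha hb h3 hab h2.symm h1.symm) with h | h
        · exact Or.inr ⟨h3, h⟩
        · exact Or.inl ⟨h3, h⟩
    rw [this, card_erase_of_mem (by simp [hb, hab.symm]), card_erase_of_mem ha]
    have : 1 < #P := one_lt_card.2 ⟨a, ha, b, hb, hab⟩
    omega
  · rw [disjoint_left]
    intro p
    simp only [mem_filter]
    rintro ⟨-, h⟩ ⟨-, h'⟩
    exact lt_asymm h h'

open Classical in
theorem sum_separates (P : Finset Plane) :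
    ∑ a ∈ P, ∑ b ∈ P, ∑ c ∈ P, ∑ d ∈ P, (if Separates a b c d then 1 else 0) =
      2 * ∑ a ∈ P, ∑ b ∈ P, left P a b * left P b a := by
  simp only [mul_sum]
  refine sum_congr rfl fun a _ => sum_congr rfl fun b _ => ?_
  have h : ∀ c d, (if Separates a b c d then 1 else 0) =
      (if 0 < orient a b c then 1 else 0) * (if orient a b d < 0 then 1 else 0) +
      (if orient a b c < 0 then 1 else 0) * (if 0 < orient a b d then 1 else 0) := by
    intro c d
    unfold Separates
    rcases lt_trichotomy (orient a b c) 0 with h | h | h <;>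
    rcases lt_trichotomy (orient a b d) 0 with h' | h' | h' <;>
    simp [h, h', not_lt.2 h.le, not_lt.2 h'.le]
  simp only [h, sum_add_distrib, ← mul_sum, ← sum_mul, ← card_filter]
  rw [left_swap P a b, left]
  ring

theorem crossings_finite (P : Finset Plane) : (crossings P).Finite := by
  classical
  refine ((P ×ˢ P ×ˢ P ×ˢ P).image fun x : Plane × Plane × Plane × Plane =>
    s(s(x.1, x.2.1), s(x.2.2.1, x.2.2.2))).finite_toSet.subset ?_
  rintro x ⟨a, ha, b, hb, c, hc, d, hd, -, -, -, rfl, -⟩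
  simp only [coe_image, Set.mem_image, mem_coe, mem_product, Prod.exists]
  exact ⟨a, b, c, d, ⟨ha, hb, hc, hd⟩, rfl⟩

open Classical in
theorem sum_crossing_le (P : Finset Plane) :
    ∑ a ∈ P, ∑ b ∈ P, ∑ c ∈ P, ∑ d ∈ P,
      (if Separates a b c d ∧ Separates c d a b then 1 else 0) ≤ 8 * cr P := by
  set S : Finset (Plane × Plane × Plane × Plane) := {x ∈ P ×ˢ P ×ˢ P ×ˢ P |
    Separates x.1 x.2.1 x.2.2.1 x.2.2.2 ∧ Separates x.2.2.1 x.2.2.2 x.1 x.2.1} with hS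
  have hcard : ∑ a ∈ P, ∑ b ∈ P, ∑ c ∈ P, ∑ d ∈ P,
      (if Separates a b c d ∧ Separates c d a b then 1 else 0) = #S := by
    rw [hS, card_filter, sum_product]
    simp only [sum_product]
  let f : Plane × Plane × Plane × Plane → Sym2 (Sym2 Plane) := fun x =>
    s(s(x.1, x.2.1), s(x.2.2.1, x.2.2.2))
  have hfib : ∀ y ∈ S.image f, #{x ∈ S | f x = y} ≤ 8 := by
    intro y hy
    obtain ⟨⟨a, b, c, d⟩, -, rfl⟩ := mem_image.1 hy
    have hsub : {x ∈ S | f x = f (a, b, c, d)} ⊆ [(a, b, c, d), (b, a, c, d), (a, b, d, c),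
        (b, a, d, c), (c, d, a, b), (c, d, b, a), (d, c, a, b), (d, c, b, a)].toFinset := by
      rintro ⟨a', b', c', d'⟩ hx
      have hx := (mem_filter.1 hx).2
      simp only [f, Sym2.eq_iff] at hx
      simp only [List.mem_toFinset, List.mem_cons, Prod.mk.injEq, List.not_mem_nil, or_false]
      rcases hx with ⟨⟨rfl, rfl⟩ | ⟨rfl, rfl⟩, ⟨rfl, rfl⟩ | ⟨rfl, rfl⟩⟩ |
        ⟨⟨rfl, rfl⟩ | ⟨rfl, rfl⟩, ⟨rfl, rfl⟩ | ⟨rfl, rfl⟩⟩ <;> simp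
    exact (card_le_card hsub).trans (List.toFinset_card_le _)
  have himg : (↑(S.image f) : Set (Sym2 (Sym2 Plane))) ⊆ crossings P := by
    intro y hy
    obtain ⟨⟨a, b, c, d⟩, hx, rfl⟩ := mem_image.1 (mem_coe.1 hy)
    simp only [hS, mem_filter, mem_product] at hx
    obtain ⟨⟨ha, hb, hc, hd⟩, h1, h2⟩ := hx
    have hne : ∀ {a b c d : Plane}, Separates a b c d → a ≠ b := by
      rintro a b c d h rfl
      simp [Separates, orient] at h
    refine ⟨a, ha, b, hb, c, hc, d, hd, hne h1, hne h2, ?_, rfl, inter_of_separates h1 h2⟩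
    intro h
    rw [Sym2.eq_iff] at h
    rcases h with ⟨rfl, rfl⟩ | ⟨rfl, rfl⟩ <;> simp [Separates, orient] at h1
  rw [hcard]
  calc #S ≤ 8 * #(S.image f) := card_le_mul_card_image _ _ hfib
    _ ≤ 8 * cr P := by
      gcongr
      rw [cr, ← Set.ncard_coe_finset]
      exact Set.ncard_le_ncard himg (crossings_finite P)

/-- Each quadruple of points contributes a crossing or many separating lines, so few balanced
lines force many crossings. -/
theorem card_pow_le_cr {P : Finset Plane} (hP : InGeneralPosition P) :
    #P ^ 4 ≤ 4 * (∑ a ∈ P, ∑ b ∈ P, left P a b * left P b a) + 8 * cr P + 6 * #P ^ 3 := by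
  classical
  let F : Plane → Plane → Plane → Plane → ℕ := fun a b c d =>
    (if Separates a b c d then 1 else 0) + (if Separates c d a b then 1 else 0) +
        (if Separates a b c d ∧ Separates c d a b then 1 else 0)
  let D : Plane → Plane → ℕ := fun a b => if a = b then 1 else 0
  -- The terms `D` pay for quadruples with a repeated point, at a total cost of 18 n³. The three
  -- pairings contribute equal sums after renaming variables.
  have hpt : ∀ a ∈ P, ∀ b ∈ P, ∀ c ∈ P, ∀ d ∈ P,
      3 ≤ F a b c d + F a c b d + F a d b c +
        3 * (D a b + D a c + D a d + D b c + D b d + D c d) := by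
    intro a ha b hb c hc d hd
    by_cases h1 : a = b
    · simp only [D, h1]; simp; omega
    by_cases h2 : a = c
    · simp only [D, h2]; simp; omega
    by_cases h3 : a = d
    · simp only [D, h3]; simp; omega
    by_cases h4 : b = c
    · simp only [D, h4]; simp; omega
    by_cases h5 : b = d
    · simp only [D, h5]; simp; omega
    by_cases h6 : c = d
    · simp only [D, h6]; simp; omega
    exact (three_le_separates (orient_ne_zero hP ha hb hc h1 h2 h4)
      (orient_ne_zero hP ha hb hd h1 h3 h5) (orient_ne_zero hP ha hc hd h2 h3 h6)
      (orient_ne_zero hP hb hc hd h4 h5 h6)).trans (Nat.le_add_right _ _)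
  have hsum := sum_le_sum fun a ha => sum_le_sum fun b hb => sum_le_sum fun c hc =>
    sum_le_sum fun d hd => hpt a ha b hb c hc d hd
  have hD : ∀ a ∈ P, ∑ b ∈ P, D a b = 1 := by
    intro a ha
    simp [D, ha]
  have hD2 : ∑ a ∈ P, ∑ b ∈ P, D a b = #P := by
    rw [sum_congr rfl hD]; simp
  have hF2 : ∑ a ∈ P, ∑ b ∈ P, ∑ c ∈ P, ∑ d ∈ P, F a c b d =
      ∑ a ∈ P, ∑ b ∈ P, ∑ c ∈ P, ∑ d ∈ P, F a b c d :=
    sum_congr rfl fun a _ => sum_comm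
  have hF3 : ∑ a ∈ P, ∑ b ∈ P, ∑ c ∈ P, ∑ d ∈ P, F a d b c =
      ∑ a ∈ P, ∑ b ∈ P, ∑ c ∈ P, ∑ d ∈ P, F a b c d := by
    refine sum_congr rfl fun a _ => ?_
    calc _ = ∑ b ∈ P, ∑ d ∈ P, ∑ c ∈ P, F a d b c := sum_congr rfl fun _ _ => sum_comm
      _ = _ := sum_comm
  have hF : ∑ a ∈ P, ∑ b ∈ P, ∑ c ∈ P, ∑ d ∈ P, F a b c d ≤
      2 * (2 * ∑ a ∈ P, ∑ b ∈ P, left P a b * left P b a) + 8 * cr P := by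
    have h1 := sum_separates P
    have h2 : ∑ a ∈ P, ∑ b ∈ P, ∑ c ∈ P, ∑ d ∈ P, (if Separates c d a b then 1 else 0) =
        2 * ∑ a ∈ P, ∑ b ∈ P, left P a b * left P b a := by
      rw [← h1]
      calc _ = ∑ a ∈ P, ∑ c ∈ P, ∑ b ∈ P, ∑ d ∈ P, (if Separates c d a b then 1 else 0) :=
            sum_congr rfl fun _ _ => sum_comm
        _ = ∑ c ∈ P, ∑ a ∈ P, ∑ b ∈ P, ∑ d ∈ P, (if Separates c d a b then 1 else 0) := sum_comm
        _ = ∑ c ∈ P, ∑ a ∈ P, ∑ d ∈ P, ∑ b ∈ P, (if Separates c d a b then 1 else 0) :=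
            sum_congr rfl fun _ _ => sum_congr rfl fun _ _ => sum_comm
        _ = _ := sum_congr rfl fun _ _ => sum_comm
    have h3 := sum_crossing_le P
    simp only [F, sum_add_distrib]
    rw [h1, h2]
    omega
  have hDs : ∀ a b c d e f : ℕ, a = #P ^ 3 → b = #P ^ 3 → c = #P ^ 3 → d = #P ^ 3 →
      e = #P ^ 3 → f = #P ^ 3 → 3 * (a + b + c + d + e + f) = 18 * #P ^ 3 := by
    intros; subst_vars; ring
  simp only [sum_add_distrib, hF2, hF3, ← mul_sum] at hsum
  rw [hDs] at hsum
  · simp only [sum_const, smul_eq_mul] at hsum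
    have : #P * (#P * (#P * (#P * 3))) = 3 * #P ^ 4 := by ring
    omega
  all_goals
    simp only [sum_const, smul_eq_mul, ← mul_sum, hD2]
    ring

/-! ### Deep pairs -/

/-- At least `k` points of `P` lie on each side of the line `ab`. -/
def Deep (P : Finset Plane) (k : ℕ) (a b : Plane) : Prop := k ≤ left P a b ∧ k ≤ left P b a

theorem Deep.symm {P : Finset Plane} {k : ℕ} {a b : Plane} (h : Deep P k a b) : Deep P k b a :=
  ⟨h.2, h.1⟩

/-- Summation by parts for the product of the numbers of points on the two sides of a line. -/
theorem mul_le_sum_width {l r n : ℕ} (h : l + r + 2 = n) :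
    (l * r : ℝ) ≤ ∑ k ∈ range (n / 2), if k ≤ l ∧ k ≤ r then ((n : ℝ) - 1 - 2 * k) else 0 := by
  wlog hlr : l ≤ r generalizing l r with H
  · have := H (l := r) (r := l) (by omega) (by omega)
    rw [mul_comm]
    simpa [and_comm] using this
  have hsub : range (l + 1) ⊆ range (n / 2) := by
    rw [range_subset_range]; omega
  have hn : (n : ℝ) = l + r + 2 := by rw [← h]; push_cast; ring
  have h1 : ∀ N : ℕ, ∑ k ∈ range N, ((n : ℝ) - 1 - 2 * k) = N * (n - N) := by
    intro N
    induction N with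
    | zero => simp
    | succ N ih => rw [sum_range_succ, ih]; push_cast; ring
  -- With l ≤ r the admissible k are 0, …, l, and their weights add up to (l + 1)(r + 1).
  calc (l * r : ℝ) ≤ ((l + 1 : ℕ) : ℝ) * (n - (l + 1 : ℕ)) := by
        rw [hn]; push_cast
        have : (0 : ℝ) ≤ l := Nat.cast_nonneg l
        have : (0 : ℝ) ≤ r := Nat.cast_nonneg r
        nlinarith
    _ = ∑ k ∈ range (l + 1), ((n : ℝ) - 1 - 2 * k) := (h1 _).symm
    _ = ∑ k ∈ range (l + 1), if k ≤ l ∧ k ≤ r then ((n : ℝ) - 1 - 2 * k) else 0 := by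
        refine sum_congr rfl fun k hk => ?_
        rw [mem_range] at hk
        rw [if_pos ⟨by omega, by omega⟩]
    _ ≤ _ := by
        refine sum_le_sum_of_subset_of_nonneg hsub fun k hk _ => ?_
        rw [mem_range] at hk
        split_ifs
        · have : 1 + 2 * k ≤ n := by omega
          have : (1 : ℝ) + 2 * k ≤ n := by exact_mod_cast this
          linarith
        · exact le_rfl

open Classical in
theorem sum_left_mul_left_le {P : Finset Plane} (hP : InGeneralPosition P) :
    ((∑ a ∈ P, ∑ b ∈ P, left P a b * left P b a : ℕ) : ℝ) ≤
      ∑ k ∈ range (#P / 2), ((#P : ℝ) - 1 - 2 * k) *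
        #{x ∈ P ×ˢ P | x.1 ≠ x.2 ∧ Deep P k x.1 x.2} := by
  have h : ∀ a ∈ P, ∀ b ∈ P, ((left P a b : ℝ) * left P b a) ≤
      ∑ k ∈ range (#P / 2), ((#P : ℝ) - 1 - 2 * k) * (if a ≠ b ∧ Deep P k a b then 1 else 0) := by
    intro a ha b hb
    by_cases hab : a = b
    · subst hab
      have : left P a a = 0 := by simp [left, orient]
      simp [this]
    · refine (mul_le_sum_width (left_add_left hP ha hb hab)).trans (le_of_eq ?_)
      refine sum_congr rfl fun k _ => ?_
      simp [hab, Deep]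
  push_cast
  refine (sum_le_sum fun a ha => sum_le_sum fun b hb => h a ha b hb).trans (le_of_eq ?_)
  rw [← sum_product', sum_comm]
  refine sum_congr rfl fun k _ => ?_
  rw [← mul_sum, card_filter]
  push_cast
  rfl

/-! ### Rotating a line about a point -/

/-- The position of `p` along the direction `e`. -/
noncomputable def coord (e p : Plane) : ℝ := e 0 * p 0 + e 1 * p 1

theorem inner_eq_coord (e p : Plane) : inner ℝ e p = coord e p := by
  simp [coord, PiLp.inner_apply, Fin.sum_univ_two, mul_comm]

/-- The position of `p` along the direction `e` rotated by a right angle. -/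
noncomputable def coordPerp (e p : Plane) : ℝ := -e 1 * p 0 + e 0 * p 1

theorem coord_mul_sub (e a b c : Plane) :
    (coord e b - coord e a) * (coordPerp e c - coordPerp e a) -
      (coordPerp e b - coordPerp e a) * (coord e c - coord e a) =
      (e 0 ^ 2 + e 1 ^ 2) * orient a b c := by
  unfold coord coordPerp orient; ring

/-- `i` clamped to the interval `[k, n - 1 - k]`. -/
def clamp (n k : ℕ) (i : ℕ) : ℤ := max k (min i (n - 1 - k))

/-- This turns depth into an increment of a function of the rank, so that counts of deep pairs
telescope along the rotation. -/
theorem clamp_succ_sub {n k l r : ℕ} (h : l + r + 2 = n) (hk : 2 * k + 1 ≤ n)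
    [Decidable (k ≤ l ∧ k ≤ r)] :
    clamp n k (l + 1) - clamp n k l = if k ≤ l ∧ k ≤ r then 1 else 0 := by
  unfold clamp
  push_cast
  split_ifs with h1
  · omega
  · omega

open Classical in
/-- Rotating a line about a point `a` of `P` by a half turn moves the rank of `a` from one end of
the range of deep ranks to the other. -/
theorem card_deep_sub_card_deep {P : Finset Plane} (hP : InGeneralPosition P) {e : Plane}
    (he : Set.InjOn (coord e) P) {k : ℕ} (hk : 2 * k + 1 ≤ #P) {a : Plane} (ha : a ∈ P) :
    (#{q ∈ P | coord e a < coord e q ∧ Deep P k a q} : ℤ) -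
      #{q ∈ P | coord e q < coord e a ∧ Deep P k a q} =
    clamp #P k #{q ∈ P | coord e a < coord e q} - clamp #P k #{q ∈ P | coord e q < coord e a} := by
  by_cases hE : e 0 ^ 2 + e 1 ^ 2 = 0
  · have h0 : e 0 = 0 := by nlinarith [sq_nonneg (e 0), sq_nonneg (e 1)]
    have h1 : e 1 = 0 := by nlinarith [sq_nonneg (e 0), sq_nonneg (e 1)]
    simp [coord, h0, h1]
  have hE : 0 < e 0 ^ 2 + e 1 ^ 2 := lt_of_le_of_ne (by positivity) (Ne.symm hE)
  set x : Plane → ℝ := fun p => coord e p - coord e a with hx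
  set y : Plane → ℝ := fun p => coordPerp e p - coordPerp e a with hy
  have hxy : ∀ p q, x p * y q - y p * x q = (e 0 ^ 2 + e 1 ^ 2) * orient a p q :=
    fun p q => coord_mul_sub e a p q
  have hx0 : ∀ p ∈ P.erase a, x p ≠ 0 := fun p hp h =>
    (mem_erase.1 hp).1 (he (mem_erase.1 hp).2 ha (sub_eq_zero.1 h))
  -- Minus the slope of the line `a p`, the time at which the rotating line meets p. General
  -- position makes these times distinct.
  set τ : Plane → ℝ := fun p => -(y p / x p) with hτ
  have hττ : ∀ p ∈ P.erase a, ∀ q ∈ P.erase a,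
      τ q - τ p = (e 0 ^ 2 + e 1 ^ 2) * -orient a p q / (x p * x q) := by
    intro p hp q hq
    have h1 := hx0 p hp
    have h2 := hx0 q hq
    have := hxy p q
    rw [hτ]
    field_simp
    linarith
  have hτinj : Set.InjOn τ (P.erase a) := by
    intro p hp q hq h
    by_contra hpq
    have h1 := hττ p hp q hq
    have h2 := orient_ne_zero hP ha (mem_erase.1 hp).2 (mem_erase.1 hq).2 (mem_erase.1 hp).1.symm
      (mem_erase.1 hq).1.symm hpq
    rw [h, sub_self] at h1
    have h3 := hx0 p hp
    have h4 := hx0 q hq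
    have : (e 0 ^ 2 + e 1 ^ 2) * -orient a p q / (x p * x q) ≠ 0 :=
      div_ne_zero (mul_ne_zero hE.ne' (neg_ne_zero.2 h2)) (mul_ne_zero h3 h4)
    exact this h1.symm
  -- The sign makes deep points ahead of `a` count +1 and those behind it -1.
  have hw := sum_walk (P.erase a) τ (fun p => 0 < x p) hτinj (fun i => -clamp #P k i)
  -- the number of points below `a` when the line passes through `q`
  have hrank : ∀ q ∈ P.erase a,
      #{p ∈ P.erase a | (0 < x p ∧ τ q < τ p) ∨ (¬ 0 < x p ∧ τ p < τ q)} =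
        if 0 < x q then left P q a else left P a q := by
    intro q hq
    have key : ∀ p ∈ P.erase a, ((0 < x p ∧ τ q < τ p) ∨ (¬ 0 < x p ∧ τ p < τ q)) ↔
        0 < -orient a q p * x q := by
      intro p hp
      have h1 := hττ q hq p hp
      have h2 := hx0 p hp
      have h3 := hx0 q hq
      have h4 : (τ p - τ q) * x p * x q ^ 2 = (e 0 ^ 2 + e 1 ^ 2) * (-orient a q p * x q) := by
        rw [h1]; field_simp
      have h5 : 0 < -orient a q p * x q ↔ 0 < (τ p - τ q) * x p := by
        rw [← mul_pos_iff_of_pos_left hE, ← h4, mul_pos_iff_of_pos_right (by positivity)]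
      rw [h5]
      rcases lt_or_gt_of_ne h2 with h | h
      · rw [← neg_mul_neg, mul_pos_iff_of_pos_right (neg_pos.2 h), neg_pos]
        simp [not_lt.2 h.le]
      · rw [mul_pos_iff_of_pos_right h]
        simp [h]
    rw [filter_congr key]
    have h0 : ∀ Q : Plane → Prop, ¬ Q a → #{p ∈ P.erase a | Q p} = #{p ∈ P | Q p} := by
      intro Q hQ
      congr 1
      ext p
      simp only [mem_filter, mem_erase]
      exact ⟨fun h => ⟨h.1.2, h.2⟩, fun h => ⟨⟨fun h' => hQ (h' ▸ h.2), h.1⟩, h.2⟩⟩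
    rw [h0 _ (by simp [orient])]
    split_ifs with h
    · simp only [left, mul_pos_iff_of_pos_right h, orient_swap a q]
    · have h := lt_of_le_of_ne (not_lt.1 h) (hx0 q hq)
      have : ∀ p, 0 < -orient a q p * x q ↔ 0 < orient a q p := by
        intro p
        rw [neg_mul, ← mul_neg, mul_pos_iff_of_pos_right (neg_pos.2 h)]
      simp only [left, this]
  have hterm : ∀ q ∈ P.erase a, (if 0 < x q then (-1 : ℤ) else 1) *
      (-clamp #P k (#{p ∈ P.erase a | (0 < x p ∧ τ q < τ p) ∨ (¬ 0 < x p ∧ τ p < τ q)} + 1) -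
        -clamp #P k #{p ∈ P.erase a | (0 < x p ∧ τ q < τ p) ∨ (¬ 0 < x p ∧ τ p < τ q)}) =
      (if coord e a < coord e q ∧ Deep P k a q then 1 else 0) -
        (if coord e q < coord e a ∧ Deep P k a q then 1 else 0) := by
    intro q hq
    rw [hrank q hq]
    have h1 := left_add_left hP ha (mem_erase.1 hq).2 (mem_erase.1 hq).1.symm
    have h2 := clamp_succ_sub h1 hk
    have h3 := clamp_succ_sub (l := left P q a) (r := left P a q) (by omega) hk
    have hd : (k ≤ left P q a ∧ k ≤ left P a q) ↔ Deep P k a q := and_comm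
    have hd' : (k ≤ left P a q ∧ k ≤ left P q a) ↔ Deep P k a q := Iff.rfl
    rw [if_congr hd rfl rfl] at h3
    rw [if_congr hd' rfl rfl] at h2
    by_cases h : 0 < x q
    · have h4 : coord e a < coord e q := sub_pos.1 h
      simp only [h, h4, not_lt.2 h4.le, if_true, true_and, false_and, if_false]
      linarith
    · have h4 : coord e q < coord e a := by
        have := lt_of_le_of_ne (not_lt.1 h) (hx0 q hq)
        exact sub_neg.1 this
      simp only [h, h4, not_lt.2 h4.le, true_and, false_and, if_false]
      linarith
  rw [sum_congr rfl hterm, sum_sub_distrib] at hw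
  have herase : ∀ Q : Plane → Prop, ¬ Q a → #{p ∈ P.erase a | Q p} = #{p ∈ P | Q p} := by
    intro Q hQ
    congr 1
    ext p
    simp only [mem_filter, mem_erase]
    exact ⟨fun h => ⟨h.1.2, h.2⟩, fun h => ⟨⟨fun h' => hQ (h' ▸ h.2), h.1⟩, h.2⟩⟩
  have hneg : #{p ∈ P.erase a | ¬ 0 < x p} = #{p ∈ P | coord e p < coord e a} := by
    rw [← herase (fun p => coord e p < coord e a) (lt_irrefl _)]
    congr 1
    refine filter_congr fun p hp => ?_
    have := hx0 p hp
    rw [not_lt]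
    exact ⟨fun h => sub_neg.1 (lt_of_le_of_ne h this), fun h => (sub_neg.2 h).le⟩
  have hpos : #{p ∈ P.erase a | 0 < x p} = #{p ∈ P | coord e a < coord e p} := by
    rw [← herase (fun p => coord e a < coord e p) (lt_irrefl _)]
    congr 1
    exact filter_congr fun p hp => sub_pos
  rw [hneg, hpos] at hw
  have e1 : #{q ∈ P | coord e a < coord e q ∧ Deep P k a q} =
      #{q ∈ P.erase a | coord e a < coord e q ∧ Deep P k a q} := by
    convert (herase (fun q => coord e a < coord e q ∧ Deep P k a q) (by simp)).symm
  have e2 : #{q ∈ P | coord e q < coord e a ∧ Deep P k a q} =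
      #{q ∈ P.erase a | coord e q < coord e a ∧ Deep P k a q} := by
    convert (herase (fun q => coord e q < coord e a ∧ Deep P k a q) (by simp)).symm
  rw [e1, e2]
  simp only [card_filter]
  push_cast
  rw [hw]
  simp only [card_filter]
  ring

/-! ### Deep pairs meeting a class cut off by a line -/

/-- A small multiple of the perpendicular added to `e` breaks all ties and preserves the finitely
many strict inequalities. The rotation argument needs distinct positions. -/
theorem exists_coord_injOn (P : Finset Plane) {e : Plane} (he : e 0 ^ 2 + e 1 ^ 2 ≠ 0) :
    ∃ e' : Plane, Set.InjOn (coord e') P ∧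
      ∀ p ∈ P, ∀ q ∈ P, coord e p < coord e q → coord e' p < coord e' q := by
  let d : ℝ → Plane := fun ε => !₂[e 0 - ε * e 1, e 1 + ε * e 0]
  have hd : ∀ ε p, coord (d ε) p = coord e p + ε * coordPerp e p := by
    intro ε p
    simp [d, coord, coordPerp]
    ring
  have hev : ∀ p ∈ P, ∀ q ∈ P, ∀ᶠ ε in nhdsWithin (0 : ℝ) (Set.Ioi 0),
      (coord e p < coord e q → coord (d ε) p < coord (d ε) q) ∧
        (coord (d ε) p = coord (d ε) q → p = q) := by
    have hlt : ∀ p q, coord e p < coord e q →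
        ∀ᶠ ε in nhdsWithin (0 : ℝ) (Set.Ioi 0), coord (d ε) p < coord (d ε) q := by
      intro p q h
      simp only [hd]
      apply eventually_nhdsWithin_of_eventually_nhds
      have hc : Continuous fun ε : ℝ =>
          (coord e q + ε * coordPerp e q) - (coord e p + ε * coordPerp e p) := by fun_prop
      filter_upwards [hc.continuousAt.eventually (lt_mem_nhds (a := 0) (b := _) (by simpa using h))]
        with ε hε
      linarith
    intro p _ q _
    rcases lt_trichotomy (coord e p) (coord e q) with h | h | h
    · filter_upwards [hlt p q h] with ε hε
      exact ⟨fun _ => hε, fun h' => absurd h' hε.ne⟩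
    · filter_upwards [self_mem_nhdsWithin] with ε hε
      refine ⟨fun h' => absurd h h'.ne, fun h' => ?_⟩
      rw [hd, hd, h] at h'
      have hε : ε ≠ 0 := ne_of_gt hε
      have h2 : coordPerp e p = coordPerp e q := mul_left_cancel₀ hε (by linarith)
      unfold coord at h
      unfold coordPerp at h2
      have h3 : (e 0 ^ 2 + e 1 ^ 2) * (p 0 - q 0) = 0 := by linear_combination e 0 * h - e 1 * h2
      have h4 : (e 0 ^ 2 + e 1 ^ 2) * (p 1 - q 1) = 0 := by linear_combination e 1 * h + e 0 * h2
      have h3 := (mul_eq_zero.1 h3).resolve_left he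
      have h4 := (mul_eq_zero.1 h4).resolve_left he
      ext i
      fin_cases i
      · exact sub_eq_zero.1 h3
      · exact sub_eq_zero.1 h4
    · filter_upwards [hlt q p h] with ε hε
      exact ⟨fun h' => absurd h' h.not_gt, fun h' => absurd h' hε.ne'⟩
  have hall : ∀ᶠ ε in nhdsWithin (0 : ℝ) (Set.Ioi 0), ∀ p ∈ P, ∀ q ∈ P,
      (coord e p < coord e q → coord (d ε) p < coord (d ε) q) ∧
        (coord (d ε) p = coord (d ε) q → p = q) := by
    rw [Filter.eventually_all_finset]
    intro p hp
    rw [Filter.eventually_all_finset]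
    exact hev p hp
  obtain ⟨ε, hε⟩ := hall.exists
  exact ⟨d ε, fun p hp q hq h => (hε p hp q hq).2 h, fun p hp q hq h => (hε p hp q hq).1 h⟩

theorem exists_enumeration {α : Type*} [DecidableEq α] [Nonempty α] (X : Finset α) (x : α → ℝ)
    (hx : Set.InjOn x X) :
    ∃ p : ℕ → α, (range #X).image p = X ∧ ∀ i j, i < j → j < #X → x (p i) < x (p j) := by
  induction X using Finset.induction_on_max_value x with
  | empty => exact ⟨fun _ => Classical.arbitrary α, by simp, by simp⟩
  | insert a s ha hmax ih =>
    obtain ⟨p, hp, hlt⟩ := ih (hx.mono (by simp))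
    rw [card_insert_of_notMem ha]
    refine ⟨Function.update p #s a, ?_, ?_⟩
    · rw [range_add_one, image_insert, Function.update_self]
      congr 1
      conv_rhs => rw [← hp]
      refine image_congr fun i hi => ?_
      rw [mem_coe, mem_range] at hi
      exact Function.update_of_ne hi.ne _ _
    · intro i j hij hj
      have hi : i ≠ #s := by omega
      rw [Function.update_of_ne hi]
      by_cases hjs : j = #s
      · rw [hjs, Function.update_self]
        have hps : p i ∈ s := by
          rw [← hp]
          exact mem_image_of_mem _ (mem_range.2 (by omega))
        refine lt_of_le_of_ne (hmax _ hps) fun h => ha ?_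
        rwa [← hx (by simp [hps]) (by simp) h]
      · rw [Function.update_of_ne hjs]
        exact hlt i j hij (by omega)

open Classical in
theorem sum_lt_eq_pairCount (R : ℕ → ℕ → Prop) (m : ℕ) :
    ∑ i ∈ range m, #{j ∈ range m | j < i ∧ R i j} = pairCount (fun i j => R j i) m := by
  unfold pairCount
  refine sum_congr rfl fun j hj => ?_
  rw [mem_range] at hj
  congr 1
  ext i
  simp only [mem_filter, mem_range]
  constructor
  · rintro ⟨-, h⟩; exact h
  · rintro ⟨h1, h2⟩; exact ⟨by omega, h1, h2⟩

open Classical in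
theorem sum_gt_eq_pairCount (R : ℕ → ℕ → Prop) (m : ℕ) :
    ∑ i ∈ range m, #{j ∈ range m | i < j ∧ R i j} = pairCount R m := by
  rw [show pairCount R m = pairCount (fun i j => (fun a b => R b a) j i) m from rfl,
    ← sum_lt_eq_pairCount]
  simp only [card_filter]
  rw [sum_comm]

open Classical in
/-- The deep pairs meeting a class `X` that precedes the rest of `P` in some direction. -/
theorem deep_pairs_of_precedes {P : Finset Plane} (hP : InGeneralPosition P) {e : Plane}
    {X : Finset Plane} (hXP : X ⊆ P) (he : e 0 ^ 2 + e 1 ^ 2 ≠ 0)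
    (hX : ∀ x ∈ X, ∀ z ∈ P \ X, coord e x < coord e z) {k : ℕ} (hk : 2 * k + 1 ≤ #P)
    (hm : 2 * #X ≤ #P) :
    (#{x ∈ X ×ˢ (P \ X) | Deep P k x.1 x.2} : ℤ) =
        ∑ i ∈ range #X, ((#P : ℤ) - 1 - 2 * max i k) ∧
      ((∀ J : ℕ, 2 * k + 2 ≤ #P → (#{x ∈ X ×ˢ X | x.1 ≠ x.2 ∧ Deep P k x.1 x.2} : ℝ) ≤
        (#X : ℝ) ^ 2 - ∑ j ∈ range J,
          (max 0 (2 * #X - ((j : ℝ) + 1) * (j + 2) * (#P - 1 - 2 * k))) ^ 2 /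
            (4 * ((j + 1) * (j + 2))) + 4 * #X)) := by
  obtain ⟨e, hinj, hmono⟩ := exists_coord_injOn P he
  replace hX : ∀ x ∈ X, ∀ z ∈ P \ X, coord e x < coord e z := fun x hx z hz =>
    hmono x (hXP hx) z (mem_sdiff.1 hz).1 (hX x hx z hz)
  obtain ⟨p, hp, hlt⟩ := exists_enumeration X (coord e) (hinj.mono (by exact_mod_cast hXP))
  set m := #X with hmX
  set R : ℕ → ℕ → Prop := fun i j => Deep P k (p i) (p j) with hR
  have hlt' : ∀ i < m, ∀ j < m, coord e (p i) < coord e (p j) ↔ i < j := by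
    intro i hi j hj
    refine ⟨fun h => ?_, fun h => hlt i j h hj⟩
    by_contra hij
    rcases (not_lt.1 hij).lt_or_eq with h' | h'
    · exact lt_asymm h (hlt j i h' hi)
    · rw [h'] at h; exact lt_irrefl _ h
  have hpinj : Set.InjOn p (range m) := by
    intro i hi j hj h
    rw [mem_coe, mem_range] at hi hj
    by_contra hij
    rcases lt_or_gt_of_ne hij with h' | h'
    · exact (hlt i j h' hj).ne (by rw [h])
    · exact (hlt j i h' hi).ne (by rw [h])
  have hmem : ∀ i < m, p i ∈ X := fun i hi => by
    rw [← hp]; exact mem_image_of_mem _ (mem_range.2 hi)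
  have hcount : ∀ (Q : Plane → Prop) [DecidablePred Q],
      #{q ∈ X | Q q} = #{j ∈ range m | Q (p j)} := by
    intro Q _
    conv_lhs => rw [← hp]
    rw [filter_image, card_image_of_injOn (hpinj.mono (by
      rw [coe_subset]; exact filter_subset _ _))]
  have hsplit : ∀ (Q : Plane → Prop) [DecidablePred Q],
      #{q ∈ P | Q q} = #{q ∈ X | Q q} + #{q ∈ P \ X | Q q} := by
    intro Q _
    rw [← card_union_of_disjoint (disjoint_filter_filter disjoint_sdiff), ← filter_union,
      union_sdiff_of_subset hXP]
  have hbelow : ∀ Q : Plane → Prop, ∀ i < m, #{q ∈ P | coord e q < coord e (p i) ∧ Q q} =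
      #{j ∈ range m | j < i ∧ Q (p j)} := by
    intro Q i hi
    have hz : #{q ∈ P \ X | coord e q < coord e (p i) ∧ Q q} = 0 := by
      rw [card_eq_zero, filter_eq_empty_iff]
      rintro z hz ⟨h, -⟩
      exact lt_asymm h (hX _ (hmem i hi) z hz)
    rw [hsplit, hcount, hz, add_zero]
    congr 1
    refine filter_congr fun j hj => ?_
    rw [hlt' j (mem_range.1 hj) i hi]
  have habove : ∀ Q : Plane → Prop, ∀ i < m, #{q ∈ P | coord e (p i) < coord e q ∧ Q q} =
      #{j ∈ range m | i < j ∧ Q (p j)} + #{q ∈ P \ X | Q q} := by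
    intro Q i hi
    rw [hsplit, hcount]
    congr 2
    · refine filter_congr fun j hj => ?_
      rw [hlt' i hi j (mem_range.1 hj)]
    · refine filter_congr fun z hz => ?_
      simp [hX _ (hmem i hi) z hz]
  have hbelow' : ∀ i < m, #{q ∈ P | coord e q < coord e (p i)} = i := by
    intro i hi
    have := hbelow (fun _ => True) i hi
    simp only [and_true] at this
    rw [this]
    have : ({j ∈ range m | j < i} : Finset ℕ) = range i := by
      ext j; simp only [mem_filter, mem_range]; omega
    rw [this, card_range]
  have habove' : ∀ i < m, #{q ∈ P | coord e (p i) < coord e q} = #P - 1 - i := by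
    intro i hi
    have := habove (fun _ => True) i hi
    simp only [and_true] at this
    rw [this]
    have h1 : ({j ∈ range m | i < j} : Finset ℕ) = Ico (i + 1) m := by
      ext j; simp only [mem_filter, mem_range, mem_Ico]; omega
    rw [h1, Nat.card_Ico, filter_true, card_sdiff_of_subset hXP]
    have := card_le_card hXP
    omega
  -- The i-th point has i points behind it and #P - 1 - i ahead; since 2m ≤ #P, the two ranks clamp
  -- to max(i, k) and #P - 1 - max(i, k).
  have key : ∀ i < m, (#{j ∈ range m | i < j ∧ R i j} : ℤ) + #{q ∈ P \ X | Deep P k (p i) q} -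
      #{j ∈ range m | j < i ∧ R i j} = (#P : ℤ) - 1 - 2 * max i k := by
    intro i hi
    have h := card_deep_sub_card_deep hP hinj hk (hXP (hmem i hi))
    rw [hbelow (fun q => Deep P k (p i) q) i hi, habove (fun q => Deep P k (p i) q) i hi,
      hbelow' i hi, habove' i hi] at h
    have h2 : clamp #P k (#P - 1 - i) - clamp #P k i = (#P : ℤ) - 1 - 2 * max i k := by
      unfold clamp
      have : ((#P - 1 - i : ℕ) : ℤ) = #P - 1 - i := by omega
      rw [this]
      omega
    rw [h2] at h
    rw [← h]
    push_cast
    rfl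
  have hsymm : ∀ i j, R i j → R j i := fun i j h => h.symm
  have hRswap : (fun i j => R j i) = R := by
    ext i j; exact ⟨hsymm _ _, hsymm _ _⟩
  have hin := sum_lt_eq_pairCount R m
  have hout := sum_gt_eq_pairCount R m
  rw [hRswap] at hin
  refine ⟨?_, fun J hk' => ?_⟩
  -- Summed over the class, forward and backward edges inside it cancel, leaving exactly the pairs
  -- that leave it.
  · rw [← sum_congr rfl fun i hi => key i (mem_range.1 hi)]
    simp only [sum_sub_distrib, sum_add_distrib]
    have h1 : ∑ i ∈ range m, (#{j ∈ range m | i < j ∧ R i j} : ℤ) =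
        ∑ i ∈ range m, (#{j ∈ range m | j < i ∧ R i j} : ℤ) := by
      exact_mod_cast hout.trans hin.symm
    rw [h1, add_sub_cancel_left]
    have h2 : #{x ∈ X ×ˢ (P \ X) | Deep P k x.1 x.2} =
        ∑ a ∈ X, #{q ∈ P \ X | Deep P k a q} := by
      simp only [card_filter, sum_product]
    rw [h2]
    conv_lhs => rw [← hp]
    rw [sum_image hpinj, hp]
    push_cast
    rfl
  · have h2 : #{x ∈ X ×ˢ X | x.1 ≠ x.2 ∧ Deep P k x.1 x.2} = 2 * pairCount R m := by
      have h3 : #{x ∈ X ×ˢ X | x.1 ≠ x.2 ∧ Deep P k x.1 x.2} =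
          ∑ a ∈ X, #{q ∈ X | a ≠ q ∧ Deep P k a q} := by
        simp only [card_filter, sum_product]
      rw [h3]
      have h4 : ∀ i ∈ range m, #{q ∈ X | p i ≠ q ∧ Deep P k (p i) q} =
          #{j ∈ range m | i < j ∧ R i j} + #{j ∈ range m | j < i ∧ R i j} := by
        intro i hi
        rw [hcount, ← card_union_of_disjoint, ← filter_or]
        · congr 1
          refine filter_congr fun j hj => ?_
          have : p i ≠ p j ↔ i < j ∨ j < i := by
            rw [← ne_iff_lt_or_gt, not_iff_not]
            exact ⟨fun h => hpinj hi hj h, fun h => by rw [h]⟩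
          rw [this, or_and_right]
        · rw [disjoint_left]
          intro j
          simp only [mem_filter]
          omega
      conv_lhs => rw [← hp]
      rw [sum_image hpinj, hp, sum_congr rfl h4, sum_add_distrib, hin, hout]
      ring
    have hw : (1 : ℝ) ≤ (#P : ℝ) - 1 - 2 * k := by
      have : (2 * k + 2 : ℝ) ≤ #P := by exact_mod_cast hk'
      linarith
    have h5 := pairCount_le R hsymm m ((#P : ℝ) - 1 - 2 * k) hw (fun i hi => by
      have h6 := key i hi
      have h7 : (#{j ∈ range m | i < j ∧ R i j} : ℤ) - #{j ∈ range m | j < i ∧ R i j} ≤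
          (#P : ℤ) - 1 - 2 * k := by
        omega
      exact_mod_cast h7) J
    rw [h2]
    push_cast
    have h8 : ∑ j ∈ range J,
          (max 0 (2 * (m : ℝ) - ((j : ℝ) + 1) * (j + 2) * (#P - 1 - 2 * k))) ^ 2 /
            (4 * ((j + 1) * (j + 2))) = 2 * ∑ j ∈ range J,
          (max 0 (2 * (m : ℝ) - ((j : ℝ) + 1) * (j + 2) * (#P - 1 - 2 * k))) ^ 2 /
            (8 * ((j + 1) * (j + 2))) := by
      rw [mul_sum]
      refine sum_congr rfl fun j _ => ?_
      field_simp
      ring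
    rw [h8]
    linarith

/-! ### From 3-decomposability to three cut-off classes -/

/-- `X` strictly precedes the rest of `P` in some direction. -/
def Precedes (P X : Finset Plane) : Prop :=
  ∃ e : Plane, e 0 ^ 2 + e 1 ^ 2 ≠ 0 ∧ ∀ x ∈ X, ∀ z ∈ P \ X, coord e x < coord e z

theorem precedes_of_coord {P X : Finset Plane} {e : Plane} (h : (P \ X).Nonempty) (h' : X.Nonempty)
    (he : ∀ x ∈ X, ∀ z ∈ P \ X, coord e x < coord e z) : Precedes P X := by
  refine ⟨e, fun h0 => ?_, he⟩
  obtain ⟨z, hz⟩ := h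
  obtain ⟨x, hx⟩ := h'
  have h1 : e 0 = 0 := by nlinarith [sq_nonneg (e 0), sq_nonneg (e 1)]
  have h2 : e 1 = 0 := by nlinarith [sq_nonneg (e 0), sq_nonneg (e 1)]
  have := he x hx z hz
  simp [coord, h1, h2] at this

/-- If the projections show `X` between `Y` and `Z`, then `Y` and `Z` can be cut off by a line. -/
theorem ShowsBetween.precedes {P X Y Z : Finset Plane} {p q : Plane} (h : ShowsBetween p q X Y Z)
    (hX : X.Nonempty) (hY : Y.Nonempty) (hZ : Z.Nonempty) (hXY : Disjoint X Y) (hXZ : Disjoint X Z)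
    (hYZ : Disjoint Y Z) (hP : P = X ∪ Y ∪ Z) : Precedes P Y ∧ Precedes P Z := by
  have key : ∀ {Y Z : Finset Plane}, Disjoint X Y → Disjoint X Z → Disjoint Y Z → P = X ∪ Y ∪ Z →
      Y.Nonempty → Z.Nonempty → ∀ e : Plane, (∀ x ∈ X, ∀ y ∈ Y, ∀ z ∈ Z,
        coord e y < coord e x ∧ coord e x < coord e z) → Precedes P Y := by
    intro Y Z hXY hXZ hYZ hP hY hZ e h
    obtain ⟨x₀, hx₀⟩ := hX
    obtain ⟨y₀, hy₀⟩ := hY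
    obtain ⟨z₀, hz₀⟩ := hZ
    refine precedes_of_coord (e := e) ⟨x₀, ?_⟩ ⟨y₀, hy₀⟩ ?_
    · rw [mem_sdiff, hP]
      exact ⟨by simp [hx₀], disjoint_left.1 hXY hx₀⟩
    · intro y hy u hu
      rw [mem_sdiff, hP, mem_union, mem_union] at hu
      rcases hu with ⟨(hu | hu) | hu, hu'⟩
      · exact (h u hu y hy z₀ hz₀).1
      · exact absurd hu hu'
      · exact (h x₀ hx₀ y hy u hu).1.trans (h x₀ hx₀ y hy u hu).2
  have hneg : ∀ e u : Plane, coord (-e) u = -coord e u := by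
    intro e u; simp [coord]; ring
  have hP' : P = X ∪ Z ∪ Y := by rw [hP, union_right_comm]
  unfold ShowsBetween at h
  simp only [inner_eq_coord] at h
  rcases h with h | h
  · refine ⟨key hXY hXZ hYZ hP hY hZ _ h, key hXZ hXY hYZ.symm hP' hZ hY (-(q - p)) ?_⟩
    intro x hx z hz y hy
    rw [hneg, hneg, hneg]
    exact ⟨neg_lt_neg (h x hx y hy z hz).2, neg_lt_neg (h x hx y hy z hz).1⟩
  · refine ⟨key hXY hXZ hYZ hP hY hZ (-(q - p)) ?_, key hXZ hXY hYZ.symm hP' hZ hY _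
      fun x hx z hz y hy => h x hx y hy z hz⟩
    intro x hx y hy z hz
    rw [hneg, hneg, hneg]
    exact ⟨neg_lt_neg (h x hx y hy z hz).2, neg_lt_neg (h x hx y hy z hz).1⟩

/-- `P` is the disjoint union of three classes of size `m`, each of which can be cut off by a
line. -/
def CutPartition (P A B C : Finset Plane) (m : ℕ) : Prop :=
  P = A ∪ B ∪ C ∧ Disjoint A B ∧ Disjoint A C ∧ Disjoint B C ∧ #A = m ∧ #B = m ∧ #C = m ∧
    Precedes P A ∧ Precedes P B ∧ Precedes P C

/-- The projection with `A` in the middle cuts off `B` and `C`; the one with `B` in the middle cuts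
off `A`. -/
theorem ThreeDecomposable.exists_cutPartition {P : Finset Plane} (h : ThreeDecomposable P)
    (hP : P.Nonempty) : ∃ A B C m, CutPartition P A B C m := by
  classical
  obtain ⟨A, B, C, hU, hAB, hAC, hBC, h1, h2, T, -, s1, s2, -⟩ := h
  have hU : P = A ∪ B ∪ C := by
    apply coe_injective
    simpa using hU
  have hpos : 0 < #A := by
    rw [Nat.pos_iff_ne_zero]
    intro h0
    have hA := card_eq_zero.1 h0
    have hB := card_eq_zero.1 (h1 ▸ h0)
    have hC := card_eq_zero.1 (h2 ▸ h1 ▸ h0)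
    rw [hU, hA, hB, hC] at hP
    simp at hP
  have hA := card_pos.1 hpos
  have hB := card_pos.1 (h1 ▸ hpos)
  have hC := card_pos.1 (h2 ▸ h1 ▸ hpos)
  have p1 := s1.precedes hA hB hC hAB hAC hBC hU
  have p2 := s2.precedes (P := P) hB hA hC hAB.symm hBC hAC (by rw [hU, union_comm A B])
  exact ⟨A, B, C, #A, hU, hAB, hAC, hBC, rfl, h1.symm, (h1.trans h2).symm, p2.1, p1.1, p1.2⟩

theorem CutPartition.card {P A B C : Finset Plane} {m : ℕ} (h : CutPartition P A B C m) :
    #P = 3 * m := by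
  obtain ⟨hU, hAB, hAC, hBC, h1, h2, h3, -⟩ := h
  rw [hU, card_union_of_disjoint (disjoint_union_left.2 ⟨hAC, hBC⟩), card_union_of_disjoint hAB]
  omega

theorem sum_max_of_le {m k : ℕ} (h : k ≤ m) :
    ∑ i ∈ range m, ((3 * m : ℤ) - 1 - 2 * max i k) = 2 * m ^ 2 - k ^ 2 - k := by
  have h1 : ∀ N : ℕ, k ≤ N → ∀ c : ℤ, ∑ i ∈ range N, (c - 2 * max (i : ℤ) k) =
      c * N - (k ^ 2 + k + N ^ 2 - N) := by
    intro N hN c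
    induction N, hN using Nat.le_induction with
    | base =>
      have : ∀ i ∈ range k, c - 2 * max (i : ℤ) k = c - 2 * k := by
        intro i hi
        rw [mem_range] at hi
        rw [max_eq_right (by exact_mod_cast hi.le)]
      rw [sum_congr rfl this]
      simp
      ring
    | succ N hN ih =>
      rw [sum_range_succ, ih, max_eq_left (by exact_mod_cast hN)]
      push_cast
      ring
  push_cast
  rw [h1 m h]
  ring

theorem sum_max_of_ge {m k : ℕ} (h : m ≤ k) :
    ∑ i ∈ range m, ((3 * m : ℤ) - 1 - 2 * max i k) = m * (3 * m - 1 - 2 * k) := by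
  have : ∀ i ∈ range m, ((3 * m : ℤ) - 1 - 2 * max i k) = 3 * m - 1 - 2 * k := by
    intro i hi
    rw [mem_range] at hi
    rw [max_eq_right (by omega)]
  rw [sum_congr rfl this]
  simp
  ring

/-! ### Assembling the bound -/

open Classical in
theorem card_filter_product_split {P X : Finset Plane} (hX : X ⊆ P) (Q : Plane × Plane → Prop)
    [DecidablePred Q] :
    #{x ∈ X ×ˢ P | Q x} = #{x ∈ X ×ˢ X | Q x} + #{x ∈ X ×ˢ (P \ X) | Q x} := by
  rw [← card_union_of_disjoint, ← filter_union, ← product_union, union_sdiff_of_subset hX]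
  exact disjoint_filter_filter (disjoint_product.2 (Or.inr disjoint_sdiff))

open Classical in
theorem CutPartition.card_deep_le {P A B C : Finset Plane} {m : ℕ} (h : CutPartition P A B C m)
    (hP : InGeneralPosition P) {k : ℕ} (hk : 2 * k + 2 ≤ #P) (J : ℕ) :
    (#{x ∈ P ×ˢ P | x.1 ≠ x.2 ∧ Deep P k x.1 x.2} : ℝ) ≤
      3 * (∑ i ∈ range m, ((3 * m : ℤ) - 1 - 2 * max i k) : ℤ) +
      3 * min ((m : ℝ) ^ 2) ((m : ℝ) ^ 2 - ∑ j ∈ range J,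
          (max 0 (2 * m - ((j : ℝ) + 1) * (j + 2) * (3 * m - 1 - 2 * k))) ^ 2 /
            (4 * ((j + 1) * (j + 2))) + 4 * m) := by
  have hcard := h.card
  obtain ⟨hU, hAB, hAC, hBC, h1, h2, h3, pA, pB, pC⟩ := h
  set Q : Plane × Plane → Prop := fun x => x.1 ≠ x.2 ∧ Deep P k x.1 x.2 with hQ
  have key : ∀ X ⊆ P, #X = m → Precedes P X → (#{x ∈ X ×ˢ P | Q x} : ℝ) ≤
      (∑ i ∈ range m, ((3 * m : ℤ) - 1 - 2 * max i k) : ℤ) +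
      min ((m : ℝ) ^ 2) ((m : ℝ) ^ 2 - ∑ j ∈ range J,
          (max 0 (2 * m - ((j : ℝ) + 1) * (j + 2) * (3 * m - 1 - 2 * k))) ^ 2 /
            (4 * ((j + 1) * (j + 2))) + 4 * m) := by
    rintro X hX hXm ⟨e, he, hpre⟩
    obtain ⟨hbi, hmono⟩ := deep_pairs_of_precedes hP hX he hpre (k := k) (by omega) (by omega)
    have hmono := hmono J hk
    rw [hXm, hcard] at hbi hmono
    push_cast at hbi hmono
    rw [card_filter_product_split hX]
    have hbi' : (#{x ∈ X ×ˢ (P \ X) | Q x} : ℤ) ≤ #{x ∈ X ×ˢ (P \ X) | Deep P k x.1 x.2} := by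
      refine Nat.cast_le.2 (card_le_card fun x hx => ?_)
      rw [mem_filter] at hx ⊢
      exact ⟨hx.1, hx.2.2⟩
    have htriv : #{x ∈ X ×ˢ X | Q x} ≤ m ^ 2 := by
      refine (card_filter_le _ _).trans ?_
      rw [card_product, hXm, sq]
    have htriv : (#{x ∈ X ×ˢ X | Q x} : ℝ) ≤ (m : ℝ) ^ 2 := by exact_mod_cast htriv
    have hbi'' : (#{x ∈ X ×ˢ (P \ X) | Q x} : ℝ) ≤
        (∑ i ∈ range m, ((3 * m : ℤ) - 1 - 2 * max i k) : ℤ) := by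
      push_cast at hbi ⊢
      rw [hbi] at hbi'
      exact_mod_cast hbi'
    push_cast [-Int.cast_sum] at hbi'' ⊢
    have := le_min htriv hmono
    linarith
  have hsplit : #{x ∈ P ×ˢ P | Q x} ≤
      #{x ∈ A ×ˢ P | Q x} + #{x ∈ B ×ˢ P | Q x} + #{x ∈ C ×ˢ P | Q x} := by
    have : P ×ˢ P = A ×ˢ P ∪ B ×ˢ P ∪ C ×ˢ P := by
      rw [← union_product, ← union_product, ← hU]
    rw [this, filter_union, filter_union]
    exact (card_union_le _ _).trans (Nat.add_le_add_right (card_union_le _ _) _)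
  have hA := key A (by rw [hU, union_assoc]; exact subset_union_left) h1 pA
  have hB := key B (by rw [hU, union_right_comm]; exact subset_union_right) h2 pB
  have hC := key C (by rw [hU]; exact subset_union_right) h3 pC
  have hsplit : (#{x ∈ P ×ˢ P | Q x} : ℝ) ≤
      #{x ∈ A ×ˢ P | Q x} + #{x ∈ B ×ˢ P | Q x} + #{x ∈ C ×ˢ P | Q x} := by
    exact_mod_cast hsplit
  linarith

open Classical in
-- One formula for both ranges of k. For k < m only the square of 3m - w is nonzero, and it comes
-- from the pairs between classes. For k ≥ m those pairs contribute the linear term 3mw/2, and the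
-- first saving inside the classes is 3/4 (m - w)²: half of it completes the square of 3m - w, the
-- other half is the separate (m - w)² term. This is why the remaining sum starts at the factors 2 ·
-- 3.
theorem CutPartition.half_card_deep_le {P A B C : Finset Plane} {m : ℕ}
    (h : CutPartition P A B C m) (hP : InGeneralPosition P) {k : ℕ} (hk : 2 * k + 2 ≤ #P) (J : ℕ)
    (w : ℝ) (hw : w = (#P : ℝ) - 1 - 2 * k) :
    (#{x ∈ P ×ˢ P | x.1 ≠ x.2 ∧ Deep P k x.1 x.2} : ℝ) / 2 ≤
      9 * (m : ℝ) ^ 2 / 2 - 3 / 8 * (max 0 (3 * m - 1 * w)) ^ 2 - 3 / 8 * (max 0 (m - 1 * w)) ^ 2 -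
      3 / 8 * ∑ j ∈ range J, (max 0 (2 * m - ((j : ℝ) + 2) * (j + 3) * w)) ^ 2 / ((j + 2) * (j + 3))
      + 7 * m := by
  have hcard := h.card
  have hdeep := h.card_deep_le hP hk (J + 1)
  have hm1 : 1 ≤ m := by omega
  have hm1 : (1 : ℝ) ≤ m := by exact_mod_cast hm1
  have hw' : w = 3 * m - 1 - 2 * k := by rw [hw, hcard]; push_cast; ring
  have h3 : max 0 (3 * (m : ℝ) - 1 * w) = 3 * m - w := by
    rw [one_mul, max_eq_right]
    rw [hw']; have : (0 : ℝ) ≤ k := Nat.cast_nonneg k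
    linarith
  rw [h3]
  rcases lt_or_ge k m with hkm | hkm
  · have hkm' : (k : ℝ) + 1 ≤ m := by exact_mod_cast hkm
    have hwm : (m : ℝ) ≤ w := by linarith
    rw [sum_max_of_le hkm.le] at hdeep
    have h4 : max 0 ((m : ℝ) - 1 * w) = 0 := max_eq_left (by linarith)
    have h5 : ∀ j ∈ range J,
        (max 0 (2 * (m : ℝ) - ((j : ℝ) + 2) * (j + 3) * w)) ^ 2 / (((j : ℝ) + 2) * (j + 3)) = 0 := by
      intro j _
      have hj : (0 : ℝ) ≤ j := Nat.cast_nonneg j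
      have : 2 * 1 * (m : ℝ) ≤ ((j : ℝ) + 2) * (j + 3) * w := by gcongr <;> linarith
      rw [max_eq_left (by linarith)]
      simp
    rw [h4, sum_eq_zero h5]
    have h6 := hdeep.trans (add_le_add_right (mul_le_mul_of_nonneg_left (min_le_left _ _)
      (by norm_num : (0 : ℝ) ≤ 3)) _)
    push_cast at h6
    rw [hw']
    nlinarith
  · have hkm' : (m : ℝ) ≤ k := by exact_mod_cast hkm
    have hwm : w ≤ m := by linarith
    rw [sum_max_of_ge hkm] at hdeep
    have h6 := hdeep.trans (add_le_add_right (mul_le_mul_of_nonneg_left (min_le_right _ _)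
      (by norm_num : (0 : ℝ) ≤ 3)) _)
    rw [sum_range_succ', ← hw'] at h6
    have h7 : ∑ j ∈ range J,
        (max 0 (2 * (m : ℝ) - (((j + 1 : ℕ) : ℝ) + 1) * ((j + 1 : ℕ) + 2) * w)) ^ 2 /
        (4 * ((((j + 1 : ℕ) : ℝ) + 1) * ((j + 1 : ℕ) + 2))) =
        (∑ j ∈ range J,
          (max 0 (2 * (m : ℝ) - ((j : ℝ) + 2) * (j + 3) * w)) ^ 2 / ((j + 2) * (j + 3))) / 4 := by
      rw [sum_div]
      refine sum_congr rfl fun j _ => ?_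
      have e1 : ((j + 1 : ℕ) : ℝ) + 1 = j + 2 := by push_cast; ring
      have e2 : ((j + 1 : ℕ) : ℝ) + 2 = j + 3 := by push_cast; ring
      rw [e1, e2]
      field_simp
    have h4 : max 0 ((m : ℝ) - 1 * w) = m - w := by
      rw [one_mul, max_eq_right (by linarith)]
    have h8 : max 0 (2 * (m : ℝ) - (((0 : ℕ) : ℝ) + 1) * ((0 : ℕ) + 2) * w) = 2 * (m - w) := by
      rw [max_eq_right]
      · push_cast; ring
      · push_cast; linarith
    rw [h7, h8] at h6
    rw [h4]
    push_cast at h6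
    rw [← hw'] at h6
    linarith

/-- The term 9m²/2 cancels n⁴ to leading order, and the savings remain. In 82 = 81 + 1 the summands
are (3m)⁴/m⁴ and m⁴/m⁴, from the two isolated squares; the series comes from a = 2m and p =
(j+2)(j+3). -/
theorem CutPartition.cr_ge {P A B C : Finset Plane} {m : ℕ} (h : CutPartition P A B C m)
    (hP : InGeneralPosition P) (J : ℕ) :
    (82 / 64 + 1 / 4 * ∑ j ∈ range J, 1 / (((j : ℝ) + 2) * (j + 3)) ^ 3) * (m : ℝ) ^ 4 -
      10 * (#P : ℝ) ^ 3 ≤ cr P := by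
  classical
  have hcard := h.card
  set n := #P with hn
  have hnm : (n : ℝ) = 3 * m := by rw [hcard]; push_cast; ring
  have hm0 : (0 : ℝ) ≤ m := Nat.cast_nonneg m
  set S : ℝ := ((∑ a ∈ P, ∑ b ∈ P, left P a b * left P b a : ℕ) : ℝ) with hS
  have h1 : (n : ℝ) ^ 4 ≤ 4 * S + 8 * cr P + 6 * (n : ℝ) ^ 3 := by
    rw [hS]
    exact_mod_cast card_pow_le_cr hP
  have h2 : S ≤ _ := sum_left_mul_left_le hP
  let W : ℕ → ℝ := fun k => (n : ℝ) - 1 - 2 * k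
  let T : ℝ → ℝ → ℝ := fun a p => ∑ k ∈ range (n / 2), W k * (max 0 (a - p * W k)) ^ 2
  have h3 : S / 2 ≤ ∑ k ∈ range (n / 2), W k *
      (9 * (m : ℝ) ^ 2 / 2 - 3 / 8 * (max 0 (3 * m - 1 * W k)) ^ 2 -
        3 / 8 * (max 0 (m - 1 * W k)) ^ 2 -
        3 / 8 * ∑ j ∈ range J,
          (max 0 (2 * m - ((j : ℝ) + 2) * (j + 3) * W k)) ^ 2 / ((j + 2) * (j + 3)) + 7 * m) := by
    calc S / 2 ≤ (∑ k ∈ range (n / 2), W k *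
          #{x ∈ P ×ˢ P | x.1 ≠ x.2 ∧ Deep P k x.1 x.2}) / 2 := by linarith
      _ = ∑ k ∈ range (n / 2), W k *
          ((#{x ∈ P ×ˢ P | x.1 ≠ x.2 ∧ Deep P k x.1 x.2} : ℝ) / 2) := by
        rw [sum_div]
        exact sum_congr rfl fun k _ => mul_div_assoc _ _ _
      _ ≤ _ := by
        refine sum_le_sum fun k hk => mul_le_mul_of_nonneg_left ?_ ?_
        · rw [mem_range] at hk
          exact h.half_card_deep_le hP (by omega) J (W k) rfl
        · rw [mem_range] at hk
          have : 1 + 2 * k ≤ n := by omega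
          have : (1 : ℝ) + 2 * k ≤ n := by exact_mod_cast this
          simp only [W]
          linarith
  have h4 : ∑ k ∈ range (n / 2), W k *
      (9 * (m : ℝ) ^ 2 / 2 - 3 / 8 * (max 0 (3 * m - 1 * W k)) ^ 2 -
        3 / 8 * (max 0 (m - 1 * W k)) ^ 2 -
        3 / 8 * ∑ j ∈ range J,
          (max 0 (2 * m - ((j : ℝ) + 2) * (j + 3) * W k)) ^ 2 / ((j + 2) * (j + 3)) + 7 * m) =
      (9 * (m : ℝ) ^ 2 / 2 + 7 * m) * ∑ k ∈ range (n / 2), W k - 3 / 8 * T (3 * m) 1 -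
        3 / 8 * T m 1 - 3 / 8 * ∑ j ∈ range J,
          T (2 * m) (((j : ℝ) + 2) * (j + 3)) / ((j + 2) * (j + 3)) := by
    have e : ∑ j ∈ range J, T (2 * m) (((j : ℝ) + 2) * (j + 3)) / (((j : ℝ) + 2) * (j + 3)) =
        ∑ k ∈ range (n / 2), W k * ∑ j ∈ range J,
          (max 0 (2 * m - ((j : ℝ) + 2) * (j + 3) * W k)) ^ 2 / ((j + 2) * (j + 3)) := by
      simp only [T, sum_div, mul_sum]
      rw [sum_comm]
      exact sum_congr rfl fun _ _ => sum_congr rfl fun _ _ => mul_div_assoc _ _ _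
    rw [e]
    simp only [T]
    simp only [mul_sum (range (n / 2)), ← sum_sub_distrib]
    exact sum_congr rfl fun _ _ => by ring
  have h5 : ∑ k ∈ range (n / 2), W k ≤ (n : ℝ) ^ 2 / 4 := sum_width_le n
  have hT : ∀ a p : ℝ, 1 ≤ p → 0 ≤ a → a ≤ n → a ^ 4 / (24 * p ^ 2) - 4 * (n : ℝ) ^ 3 ≤ T a p :=
    fun a p hp ha han => sum_mul_sq_ge n hp ha han
  have t1 := hT (3 * m) 1 le_rfl (by positivity) hnm.ge
  have t2 := hT m 1 le_rfl (by positivity) (by linarith)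
  have t3 : 2 / 3 * (m : ℝ) ^ 4 * ∑ j ∈ range J, 1 / (((j : ℝ) + 2) * (j + 3)) ^ 3 -
      4 * (n : ℝ) ^ 3 * ∑ j ∈ range J, 1 / (((j : ℝ) + 2) * (j + 3)) ≤
      ∑ j ∈ range J, T (2 * m) (((j : ℝ) + 2) * (j + 3)) / ((j + 2) * (j + 3)) := by
    rw [mul_sum, mul_sum, ← sum_sub_distrib]
    refine sum_le_sum fun j _ => ?_
    have hj : (0 : ℝ) ≤ j := Nat.cast_nonneg j
    have t := hT (2 * m) (((j : ℝ) + 2) * (j + 3)) (by nlinarith) (by positivity) (by linarith)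
    rw [le_div_iff₀ (by positivity)]
    refine le_trans (le_of_eq ?_) t
    field_simp
    ring
  have t4 := sum_inv_le_one J
  set s₃ := ∑ j ∈ range J, 1 / (((j : ℝ) + 2) * (j + 3)) ^ 3
  set s₁ := ∑ j ∈ range J, 1 / (((j : ℝ) + 2) * (j + 3))
  have h6 : (9 * (m : ℝ) ^ 2 / 2 + 7 * m) * ∑ k ∈ range (n / 2), W k ≤
      (9 * (m : ℝ) ^ 2 / 2 + 7 * m) * ((n : ℝ) ^ 2 / 4) := by gcongr
  have h7 : 4 * (n : ℝ) ^ 3 * s₁ ≤ 4 * (n : ℝ) ^ 3 * 1 := by gcongr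
  rw [h4] at h3
  have hm3 : 0 ≤ (m : ℝ) ^ 3 := by positivity
  rw [hnm] at h1 h6 h7 t1 t2 t3 ⊢
  have h8 : (82 / 64 + 1 / 4 * s₃) * (m : ℝ) ^ 4 =
      82 / 64 * (m : ℝ) ^ 4 + 3 / 8 * (2 / 3 * (m : ℝ) ^ 4 * s₃) := by ring
  rw [h8]
  linarith

theorem tendsto_shifted_sum_inv_cube :
    Filter.Tendsto (fun J : ℕ => ∑ j ∈ range J, 1 / (((j : ℝ) + 2) * (j + 3)) ^ 3) Filter.atTop
      (nhds (10 - Real.pi ^ 2 - 1 / 8)) := by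
  have h := (tendsto_sum_inv_cube.comp (Filter.tendsto_add_atTop_nat 1)).sub_const (1 / 8)
  refine h.congr fun J => ?_
  simp only [Function.comp]
  rw [sum_range_succ']
  norm_num
  refine sum_congr rfl fun j _ => ?_
  ring

theorem cr_ge_of_threeDecomposable {P : Finset Plane} (hP : InGeneralPosition P)
    (h : ThreeDecomposable P) :
    2 / 27 * (15 - Real.pi ^ 2) * (((#P).choose 4 : ℕ) : ℝ) - 10 * (#P : ℝ) ^ 3 ≤ cr P := by
  rcases P.eq_empty_or_nonempty with rfl | hne
  · simp
  obtain ⟨A, B, C, m, hcut⟩ := h.exists_cutPartition hne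
  -- The limiting coefficient is 82/64 + (10 - π² - 1/8)/4 = (15 - π²)/4, the 1/8 being the missing
  -- first term of the series.
  have hlim := (((tendsto_shifted_sum_inv_cube.const_mul (1 / 4)).const_add (82 / 64)).mul_const
    ((m : ℝ) ^ 4)).sub_const (10 * (#P : ℝ) ^ 3)
  have hle := le_of_tendsto' hlim fun J => hcut.cr_ge hP J
  refine le_trans ?_ hle
  have hc := constant_gt
  have h1 : (((#P).choose 4 : ℕ) : ℝ) ≤ (#P : ℝ) ^ 4 / 24 := by
    have := Nat.choose_le_pow_div (α := ℝ) 4 #P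
    simpa [Nat.factorial] using this
  have h2 : 2 / 27 * (15 - Real.pi ^ 2) * (((#P).choose 4 : ℕ) : ℝ) ≤
      2 / 27 * (15 - Real.pi ^ 2) * ((#P : ℝ) ^ 4 / 24) := by
    apply mul_le_mul_of_nonneg_left h1
    linarith
  have hnm : (#P : ℝ) = 3 * m := by rw [hcut.card]; push_cast; ring
  rw [hnm] at h2 ⊢
  linarith

end GeometricDrawing

theorem theorem1 :
    (∃ K : ℝ, 0 < K ∧ ∀ P : Finset GeometricDrawing.Plane,
      GeometricDrawing.InGeneralPosition P → GeometricDrawing.ThreeDecomposable P →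
        (GeometricDrawing.cr P : ℝ) ≥
          2 / 27 * (15 - Real.pi ^ 2) * ((P.card.choose 4 : ℕ) : ℝ) - K * (P.card : ℝ) ^ 3) ∧
    (2 / 27 * (15 - Real.pi ^ 2) : ℝ) > 0.380029 :=
  ⟨⟨10, by norm_num, fun _ hP h => GeometricDrawing.cr_ge_of_threeDecomposable hP h⟩,
    GeometricDrawing.constant_gt⟩
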